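/- For $\nu,z\in\mathbb{C}$ let $$D_\nu(z)=2^{\nu/2}e^{-z^2/4}\left[\frac{\Gamma(1/2)}{\Gamma((1-\nu)/2)}\,\Phi\!\left(-\frac{\nu}{2};\frac12;\frac{z^2}{2}\right)+\frac{z}{2^{1/2}}\,\frac{\Gamma(-1/2)}{\Gamma(-\nu/2)}\,\Phi\!\left(\frac{1-\nu}{2};\frac32;\frac{z^2}{2}\right)\right]$$ be the parabolic cylinder function, where $\Phi(a;b;z)=\sum_{n\ge0}\frac{(a)_n}{(b)_n\,n!}z^n$ is Kummer's confluent hypergeometric function and $1/\Gamma$ is read as $0$ at the poles of $\Gamma$. Let $F(a,b;c;z)=\sum_{n\ge0}\frac{(a)_n(b)_n}{(c)_n\,n!}z^n$ be the Gauss hypergeometric function. Let $\nu,\mu\in\mathbb{C}$ with $\operatorname{Re}\nu<0$ and $\operatorname{Re}\mu<1$, and let $x,y\ge 0$ be real. Then $$D_\nu(x)D_\mu(y)=\frac{e^{-(x^2+y^2)/4}}{\Gamma\left(\frac{1-\nu-\mu}{2}\right)}\int_0^\infty e^{-t}\,t^{-(1+\nu+\mu)/2}(x^2+2t)^{\nu/2}(y^2+2t)^{\mu/2}\,F\!\left(-\frac{\nu}{2},-\frac{\mu}{2};\frac{1-\nu-\mu}{2};\frac{2t(x^2+y^2+2t)}{(x^2+2t)(y^2+2t)}\right)dt,$$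 where the hypergeometric series converges for every $t>0$ and the integral converges absolutely. -/

import Mathlib

/-- Kummer's confluent hypergeometric function
`Φ(a; b; z) = ∑ (a)ₙ / ((b)ₙ n!) zⁿ` (the series converges for all `z`
as soon as `b` is not a nonpositive integer). -/
noncomputable def kummerPhi (a b z : ℂ) : ℂ :=
  ∑' n : ℕ, (ascPochhammer ℂ n).eval a /
    ((ascPochhammer ℂ n).eval b * (n.factorial : ℂ)) * z ^ n

/-- The parabolic cylinder function `D_ν(z)`, defined through Kummer's function. Mathlib's
`Complex.Gamma` is `0` at its poles and division by `0` gives `0`, so that `1 / Γ` has the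
correct value `0` there. -/
noncomputable def parabolicCylinderD (ν z : ℂ) : ℂ :=
  (2 : ℂ) ^ (ν / 2) * Complex.exp (-z ^ 2 / 4) *
    (Complex.Gamma (1 / 2) / Complex.Gamma ((1 - ν) / 2) *
        kummerPhi (-ν / 2) (1 / 2) (z ^ 2 / 2) +
      z / (2 : ℂ) ^ (1 / 2 : ℂ) * (Complex.Gamma (-1 / 2) / Complex.Gamma (-ν / 2)) *
        kummerPhi ((1 - ν) / 2) (3 / 2) (z ^ 2 / 2))

/-- The argument `2t(x² + y² + 2t) / ((x² + 2t)(y² + 2t))` of the Gauss function. It lies in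
`[0, 1]` for `t > 0`. -/
noncomputable def gaussArg (x y t : ℝ) : ℝ :=
  2 * t * (x ^ 2 + y ^ 2 + 2 * t) / ((x ^ 2 + 2 * t) * (y ^ 2 + 2 * t))

/-- The integrand of the integral representation, for `t > 0`. Here `₂F₁ a b c z` is Mathlib's
Gauss function, the sum `∑ (a)ₙ (b)ₙ / ((c)ₙ n!) zⁿ`. -/
noncomputable def productIntegrand (ν μ : ℂ) (x y t : ℝ) : ℂ :=
  Complex.exp (-(t : ℂ)) * (t : ℂ) ^ (-(1 + ν + μ) / 2) *
    ((x ^ 2 + 2 * t : ℝ) : ℂ) ^ (ν / 2) * ((y ^ 2 + 2 * t : ℝ) : ℂ) ^ (μ / 2) *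
    ₂F₁ (-ν / 2) (-μ / 2) ((1 - ν - μ) / 2) ((gaussArg x y t : ℝ) : ℂ)

/-!
# A product formula for parabolic cylinder functions

Put `a = -ν/2` and `b = -μ/2`, so that `Re a > 0` and `Re b > -1/2`. Each factor has a
representation as an integral of `tricomiIntegrand`, that is of `u ^ (s - 1) e^{-u} (x² + 2u) ^ (-r)`
over `(0, ∞)`: with `(s, r) = (a, a + 1/2)` for `D_ν(x)`, `x > 0`
(`parabolicCylinderD_eq_tricomi_add_half_right`), and with `(s, r) = (b + 1/2, b)` for `D_μ(y)`,
`y ≥ 0` (`parabolicCylinderD_eq_tricomi_add_half_left`). The product of two integrals over `(0, ∞)`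
is the integral of the convolution of the integrands. In the convolution at `t` the four exponents
of the factors that are linear in the integration variable add up to `-2`, so a Möbius substitution
fixing the endpoints (`bijOn_moebius`) reduces it to Euler's integral for the Gauss function, which
is `intervalIntegral_tricomiIntegrand_mul`. As `c - a - b = 1/2` for `c = a + b + 1/2`, the Gauss
series converges absolutely up to the endpoint `1`, by the growth of Pochhammer symbols
(`summable_norm_ordinaryHypergeometricCoefficient`). For `x = 0` the argument of the Gauss function
is constantly `1` and Gauss's summation theorem replaces the convolution.

The representations of the factors come from the definition by Kummer series. Expanding
`e^{-x √(2τ)}` in powers of `√τ` shows that, for `Re a > 0`, `D_{-2a}(x)` is an explicit multiple of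
the integral of `τ ^ (a - 1) e^{-τ} e^{-x √(2τ)}`
(`parabolicCylinderD_eq_integral_exp_neg_sqrt`). Writing `e^{-x √(2τ)}` as an integral over `u` of
`exp (-u - x² τ / (2u))` against `u ^ (-3/2)` or `u ^ (-1/2)` (`integral_exp_neg_sub_div_mul_sqrt`,
`integral_exp_neg_sub_div_sqrt`) and integrating over `τ` first gives the two representations for
`Re a > 0`. The second is carried to `Re a > -1/2` by the recurrence
`D_{ν+1} = x D_ν - ν D_{ν-1}`, which the integrals satisfy because of a linear relation between
their integrands (`tricomiIntegrand_sub_half_right`).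
-/

/-! ### Pochhammer symbols and the Gamma function -/

theorem gamma_add_natCast {s : ℂ} (hs : 0 < s.re) (n : ℕ) :
    Complex.Gamma (s + n) = Complex.Gamma s * (ascPochhammer ℂ n).eval s := by
  have h : ∀ k : ℕ, s ≠ -k := by
    rintro k rfl
    simp only [Complex.neg_re, Complex.natCast_re, Left.neg_pos_iff] at hs
    exact absurd hs (not_lt.mpr k.cast_nonneg)
  rw [← Complex.Gamma_add_nat_div_Gamma_eq s h, mul_div_cancel₀ _ (Complex.Gamma_ne_zero h)]

theorem ascPochhammer_eval_ne_zero_of_re_pos {s : ℂ} (hs : 0 < s.re) (n : ℕ) :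
    (ascPochhammer ℂ n).eval s ≠ 0 := by
  rw [Ne, ascPochhammer_eval_eq_zero_iff]
  rintro ⟨k, -, hk⟩
  have := congrArg Complex.re hk
  simp only [Complex.natCast_re, Complex.neg_re] at this
  have h := k.cast_nonneg (α := ℝ)
  linarith

theorem prod_range_add_natCast_eq_ascPochhammer (s : ℂ) (n : ℕ) :
    ∏ j ∈ Finset.range n, (s + j) = (ascPochhammer ℂ n).eval s := by
  induction n with
  | zero => simp
  | succ n ih => rw [Finset.prod_range_succ, ih, ascPochhammer_succ_eval]

/-- The sequence `(s)ₙ₊₁ / (nˢ n!)` is the inverse of Euler's sequence for `Γ(s)`, so it converges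
(to `1 / Γ(s)`), also when `s` is a pole of `Γ`. -/
theorem exists_norm_ascPochhammer_le (s : ℂ) :
    ∃ C : ℝ, ∀ n : ℕ, 1 ≤ n →
      ‖(ascPochhammer ℂ (n + 1)).eval s‖ ≤ C * ((n : ℝ) ^ s.re * n.factorial) := by
  have key : ∃ l : ℂ, Filter.Tendsto (fun n : ℕ => (Complex.GammaSeq s n)⁻¹) Filter.atTop
      (nhds l) := by
    by_cases h : Complex.Gamma s = 0
    · obtain ⟨m, hm⟩ := (Complex.Gamma_eq_zero_iff s).1 h
      refine ⟨0, tendsto_const_nhds.congr' ?_⟩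
      filter_upwards [Filter.eventually_ge_atTop m] with n hn
      rw [Complex.GammaSeq, prod_range_add_natCast_eq_ascPochhammer,
        (ascPochhammer_eval_eq_zero_iff (n + 1) s).2 ⟨m, by omega, by rw [hm, neg_neg]⟩]
      simp
    · exact ⟨_, (Complex.GammaSeq_tendsto_Gamma s).inv₀ h⟩
  obtain ⟨l, hl⟩ := key
  obtain ⟨C, hC⟩ := hl.norm.bddAbove_range
  refine ⟨C, fun n hn => ?_⟩
  have h := hC ⟨n, rfl⟩
  have hn' : (0 : ℝ) < n := by exact_mod_cast hn
  simp only [Complex.GammaSeq, prod_range_add_natCast_eq_ascPochhammer, inv_div, norm_div,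
    norm_mul, Complex.norm_natCast_cpow_of_pos hn, Complex.norm_natCast] at h
  rwa [div_le_iff₀ (by positivity)] at h

theorem exists_le_norm_ascPochhammer {s : ℂ} (hs : 0 < s.re) :
    ∃ C : ℝ, 0 < C ∧ ∀ n : ℕ, 1 ≤ n →
      (n : ℝ) ^ s.re * n.factorial ≤ C * ‖(ascPochhammer ℂ (n + 1)).eval s‖ := by
  obtain ⟨C, hC⟩ := (Complex.GammaSeq_tendsto_Gamma s).norm.bddAbove_range
  refine ⟨max C 1, by positivity, fun n hn => ?_⟩
  have h := (hC ⟨n, rfl⟩).trans (le_max_left C 1)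
  have hp := norm_pos_iff.2 (ascPochhammer_eval_ne_zero_of_re_pos hs (n + 1))
  simp only [Complex.GammaSeq, prod_range_add_natCast_eq_ascPochhammer, norm_div,
    norm_mul, Complex.norm_natCast_cpow_of_pos hn, Complex.norm_natCast] at h
  rwa [div_le_iff₀ hp] at h

/-- The terms of the Gauss series at `1` are `O(n ^ (Re (a + b - c) - 1))`, so the series converges
absolutely on the closed unit disc when `Re (c - a - b) > 0`. -/
theorem summable_norm_ordinaryHypergeometricCoefficient {a b c : ℂ} (hc : 0 < c.re)
    (habc : a.re + b.re < c.re) :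
    Summable fun n : ℕ => ‖ordinaryHypergeometricCoefficient a b c n‖ := by
  obtain ⟨A, hA⟩ := exists_norm_ascPochhammer_le a
  obtain ⟨B, hB⟩ := exists_norm_ascPochhammer_le b
  obtain ⟨C, hC0, hC⟩ := exists_le_norm_ascPochhammer hc
  -- The bounds concern `(s)ₘ₊₁` with `m ≥ 1`, hence the shift by two.
  rw [← summable_nat_add_iff 2]
  have hs : Summable fun n : ℕ => A * B * C * ((n + 1 : ℕ) : ℝ) ^ (a.re + b.re - c.re - 1) := by
    refine Summable.mul_left _ ?_
    rw [summable_nat_add_iff (f := fun n : ℕ => (n : ℝ) ^ (a.re + b.re - c.re - 1)) 1]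
    exact Real.summable_nat_rpow.2 (by linarith)
  refine Summable.of_nonneg_of_le (fun _ => norm_nonneg _) (fun n => ?_) hs
  have hA' := hA (n + 1) (by omega)
  have hB' := hB (n + 1) (by omega)
  have hC' := hC (n + 1) (by omega)
  set m := n + 1 with hm
  have hm0 : (0 : ℝ) < m := by positivity
  have hp := norm_pos_iff.2 (ascPochhammer_eval_ne_zero_of_re_pos hc (m + 1))
  have hf : (0 : ℝ) < m.factorial := by positivity
  have hA0 := (norm_nonneg _).trans hA'
  have hB0 := (norm_nonneg _).trans hB'
  simp only [ordinaryHypergeometricCoefficient, norm_mul, norm_inv, Complex.norm_natCast]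
  rw [show n + 2 = m + 1 by omega, Nat.factorial_succ, Nat.cast_mul]
  have hinv : ‖(ascPochhammer ℂ (m + 1)).eval c‖⁻¹ ≤ C / ((m : ℝ) ^ c.re * m.factorial) := by
    rw [inv_le_comm₀ hp (by positivity), inv_div, div_le_iff₀ hC0, mul_comm _ C]
    exact hC'
  calc (((m + 1 : ℕ) : ℝ) * m.factorial)⁻¹ * ‖(ascPochhammer ℂ (m + 1)).eval a‖ *
        ‖(ascPochhammer ℂ (m + 1)).eval b‖ * ‖(ascPochhammer ℂ (m + 1)).eval c‖⁻¹
      ≤ ((m : ℝ) * m.factorial)⁻¹ * (A * ((m : ℝ) ^ a.re * m.factorial)) *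
        (B * ((m : ℝ) ^ b.re * m.factorial)) * (C / ((m : ℝ) ^ c.re * m.factorial)) := by
        gcongr
        all_goals first | positivity | exact mul_nonneg (by positivity) hA0 | exact m.le_succ
    _ = A * B * C * (m : ℝ) ^ (a.re + b.re - c.re - 1) := by
        rw [Real.rpow_sub hm0, Real.rpow_sub hm0, Real.rpow_add hm0, Real.rpow_one]
        field_simp

theorem hasSum_ascPochhammer_div_factorial (b : ℂ) {w : ℂ} (hw : ‖w‖ < 1) :
    HasSum (fun n : ℕ => (ascPochhammer ℂ n).eval b / n.factorial * w ^ n) ((1 - w) ^ (-b)) := by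
  have h := (Complex.one_div_one_sub_cpow_hasFPowerSeriesOnBall_zero b).hasSum (y := w)
    (by
      rw [Metric.mem_eball, edist_zero_right, ← ENNReal.coe_one, enorm_lt_coe]
      exact_mod_cast hw)
  simp only [zero_add, FormalMultilinearSeries.ofScalars_apply_eq, smul_eq_mul, one_div,
    ← Ring.multichoose_eq] at h
  rw [Complex.cpow_neg]
  have e : (fun n : ℕ => (ascPochhammer ℂ n).eval b / n.factorial * w ^ n) =
      fun n : ℕ => Ring.multichoose b n * w ^ n := by
    funext n
    have h2 := Ring.factorial_nsmul_multichoose_eq_ascPochhammer b n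
    rw [Polynomial.ascPochhammer_smeval_eq_eval, nsmul_eq_mul] at h2
    have h3 : (n.factorial : ℂ) ≠ 0 := Nat.cast_ne_zero.2 n.factorial_ne_zero
    rw [← h2, mul_div_cancel_left₀ _ h3]
  rw [e]
  exact h

/-! ### Euler's integral for the Gauss function -/

open MeasureTheory Set in
theorem integrableOn_betaIntegrand {u v : ℂ} (hu : 0 < u.re) (hv : 0 < v.re) :
    IntegrableOn (fun s : ℝ => (s : ℂ) ^ (u - 1) * (1 - (s : ℂ)) ^ (v - 1)) (Ioo 0 1) := by
  have h := Complex.betaIntegral_convergent hu hv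
  rw [intervalIntegrable_iff_integrableOn_Ioo_of_le zero_le_one] at h
  exact h

open MeasureTheory Set in
theorem setIntegral_betaIntegrand (u v : ℂ) :
    ∫ s in Ioo (0 : ℝ) 1, (s : ℂ) ^ (u - 1) * (1 - (s : ℂ)) ^ (v - 1) =
      Complex.betaIntegral u v := by
  rw [Complex.betaIntegral, intervalIntegral.integral_of_le zero_le_one,
    integral_Ioc_eq_integral_Ioo]

open MeasureTheory Set in
theorem setIntegral_norm_betaIntegrand (u v : ℂ) :
    ((∫ s in Ioo (0 : ℝ) 1, ‖(s : ℂ) ^ (u - 1) * (1 - (s : ℂ)) ^ (v - 1)‖ : ℝ) : ℂ) =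
      Complex.betaIntegral u.re v.re := by
  rw [← setIntegral_betaIntegrand, ← integral_complex_ofReal]
  refine setIntegral_congr_fun measurableSet_Ioo fun s hs => ?_
  have h1 : (0 : ℝ) < 1 - s := sub_pos.2 hs.2
  have e : (1 - (s : ℂ)) = ((1 - s : ℝ) : ℂ) := by push_cast; rfl
  simp only [e, norm_mul, Complex.norm_cpow_eq_rpow_re_of_pos hs.1,
    Complex.norm_cpow_eq_rpow_re_of_pos h1, Complex.sub_re, Complex.one_re]
  push_cast [Complex.ofReal_cpow hs.1.le, Complex.ofReal_cpow h1.le]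
  rfl

theorem betaIntegral_add_natCast_left {a d : ℂ} (ha : 0 < a.re) (hd : 0 < d.re) (n : ℕ) :
    Complex.betaIntegral (a + n) d = Complex.betaIntegral a d *
      ((ascPochhammer ℂ n).eval a / (ascPochhammer ℂ n).eval (a + d)) := by
  have had : 0 < (a + d).re := by rw [Complex.add_re]; positivity
  have han : 0 < (a + n).re := by
    rw [Complex.add_re, Complex.natCast_re]; positivity
  rw [Complex.betaIntegral_eq_Gamma_mul_div _ _ han hd,
    Complex.betaIntegral_eq_Gamma_mul_div _ _ ha hd,
    add_right_comm, gamma_add_natCast ha, gamma_add_natCast had]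
  have := Complex.Gamma_ne_zero_of_re_pos had
  have := ascPochhammer_eval_ne_zero_of_re_pos had n
  field_simp

open MeasureTheory Set in
/-- Euler's integral, including the endpoint `z = 1`: integrate the binomial series of
`(1 - z s) ^ (-b)` term by term against the Beta density. The norms of the terms integrate to the
terms of a Gauss series with real parameters. -/
theorem integral_euler_eq_ordinaryHypergeometric {a b d : ℂ} (ha : 0 < a.re) (hd : 0 < d.re)
    (hbd : b.re < d.re) {z : ℝ} (hz0 : 0 ≤ z) (hz1 : z ≤ 1) :
    ∫ s in Ioo (0 : ℝ) 1, (s : ℂ) ^ (a - 1) * (1 - (s : ℂ)) ^ (d - 1) *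
        (1 - ((z * s : ℝ) : ℂ)) ^ (-b) =
      Complex.betaIntegral a d * ₂F₁ a b (a + d) (z : ℂ) := by
  have had : 0 < (a + d).re := by rw [Complex.add_re]; positivity
  set F : ℕ → ℝ → ℂ := fun n s => (ascPochhammer ℂ n).eval b / n.factorial * (z : ℂ) ^ n *
    ((s : ℂ) ^ (a + n - 1) * (1 - (s : ℂ)) ^ (d - 1)) with hF
  have han (n : ℕ) : 0 < (a + n).re := by
    rw [Complex.add_re, Complex.natCast_re]; positivity
  have hint (n : ℕ) : Integrable (F n) (volume.restrict (Ioo 0 1)) :=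
    (integrableOn_betaIntegrand (han n) hd).const_mul _
  have hsum : Summable fun n => ∫ s in Ioo (0 : ℝ) 1, ‖F n s‖ := by
    have hs := (summable_norm_ordinaryHypergeometricCoefficient (a := (a.re : ℂ)) (b := b)
      (c := ((a + d).re : ℂ)) (by simpa using had) (by simpa using hbd)).mul_left
        ‖Complex.betaIntegral a.re d.re‖
    refine Summable.of_nonneg_of_le (fun n => integral_nonneg fun _ => norm_nonneg _)
      (fun n => ?_) hs
    have h1 : ∫ s in Ioo (0 : ℝ) 1, ‖(s : ℂ) ^ (a + n - 1) * (1 - (s : ℂ)) ^ (d - 1)‖ ≤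
        ‖Complex.betaIntegral a.re d.re *
          ((ascPochhammer ℂ n).eval (a.re : ℂ) / (ascPochhammer ℂ n).eval ((a + d).re : ℂ))‖ := by
      have h2 := setIntegral_norm_betaIntegrand (a + n) d
      have h3 := betaIntegral_add_natCast_left (a := (a.re : ℂ)) (d := (d.re : ℂ))
        (by simpa using ha) (by simpa using hd) n
      rw [Complex.add_re, Complex.ofReal_add, ← h3]
      rw [Complex.add_re, Complex.natCast_re, Complex.ofReal_add, Complex.ofReal_natCast] at h2
      rw [← h2, Complex.norm_real]
      exact le_abs_self _
    calc ∫ s in Ioo (0 : ℝ) 1, ‖F n s‖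
        = ‖(ascPochhammer ℂ n).eval b / n.factorial * (z : ℂ) ^ n‖ *
          ∫ s in Ioo (0 : ℝ) 1, ‖(s : ℂ) ^ (a + n - 1) * (1 - (s : ℂ)) ^ (d - 1)‖ := by
          rw [← integral_const_mul]
          simp only [hF, norm_mul]
      _ ≤ ‖(ascPochhammer ℂ n).eval b / n.factorial‖ * _ := by
          refine mul_le_mul ?_ h1 (integral_nonneg fun _ => norm_nonneg _) (norm_nonneg _)
          rw [norm_mul, norm_pow, Complex.norm_real, Real.norm_of_nonneg hz0]
          exact mul_le_of_le_one_right (norm_nonneg _) (pow_le_one₀ hz0 hz1)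
      _ = _ := by
          rw [← norm_mul, ← norm_mul]
          congr 1
          rw [ordinaryHypergeometricCoefficient]
          ring
  have hmain := hasSum_integral_of_summable_integral_norm hint hsum
  have hterm (n : ℕ) : ∫ s in Ioo (0 : ℝ) 1, F n s = Complex.betaIntegral a d *
      (ordinaryHypergeometricCoefficient a b (a + d) n • (z : ℂ) ^ n) := by
    simp only [hF]
    rw [integral_const_mul, setIntegral_betaIntegrand, betaIntegral_add_natCast_left ha hd,
      ordinaryHypergeometricCoefficient, smul_eq_mul]
    ring
  have hpt : ∫ s in Ioo (0 : ℝ) 1, ∑' n, F n s = ∫ s in Ioo (0 : ℝ) 1,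
      (s : ℂ) ^ (a - 1) * (1 - (s : ℂ)) ^ (d - 1) * (1 - ((z * s : ℝ) : ℂ)) ^ (-b) := by
    refine setIntegral_congr_fun measurableSet_Ioo fun s hs => ?_
    have hzs : ‖((z * s : ℝ) : ℂ)‖ < 1 := by
      rw [Complex.norm_real, Real.norm_of_nonneg (mul_nonneg hz0 hs.1.le)]
      exact (mul_le_of_le_one_left hs.1.le hz1).trans_lt hs.2
    have h := (hasSum_ascPochhammer_div_factorial b hzs).mul_left
      ((s : ℂ) ^ (a - 1) * (1 - (s : ℂ)) ^ (d - 1))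
    refine (h.congr_fun fun n => ?_).tsum_eq
    have hs0 : (s : ℂ) ≠ 0 := Complex.ofReal_ne_zero.2 hs.1.ne'
    simp only [hF]
    rw [add_sub_right_comm, Complex.cpow_add _ _ hs0, Complex.cpow_natCast]
    push_cast
    ring
  rw [hpt] at hmain
  rw [← hmain.tsum_eq, ordinaryHypergeometric_eq_tsum]
  simp only [hterm, tsum_mul_left]

/-- Gauss's summation theorem, with `d = c - a`. -/
theorem betaIntegral_mul_ordinaryHypergeometric_one {a b d : ℂ} (ha : 0 < a.re) (hd : 0 < d.re)
    (hbd : b.re < d.re) :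
    Complex.betaIntegral a d * ₂F₁ a b (a + d) (1 : ℂ) = Complex.betaIntegral a (d - b) := by
  have h := integral_euler_eq_ordinaryHypergeometric ha hd hbd zero_le_one le_rfl
  rw [Complex.ofReal_one] at h
  rw [← h, ← setIntegral_betaIntegrand]
  refine MeasureTheory.setIntegral_congr_fun measurableSet_Ioo fun s hs => ?_
  have h1 : (1 - (s : ℂ)) ≠ 0 := by
    rw [sub_ne_zero]; exact_mod_cast hs.2.ne'
  simp only [one_mul]
  rw [mul_assoc, ← Complex.cpow_add _ _ h1]
  ring_nf

/-! ### Kummer's function and the recurrence for parabolic cylinder functions -/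

theorem ascPochhammer_succ_eval_left (a : ℂ) (n : ℕ) :
    (ascPochhammer ℂ (n + 1)).eval a = a * (ascPochhammer ℂ n).eval (a + 1) := by
  simp [ascPochhammer_succ_left, Polynomial.eval_comp]

theorem summable_kummerPhi (a b z : ℂ) :
    Summable fun n : ℕ => (ascPochhammer ℂ n).eval a /
      ((ascPochhammer ℂ n).eval b * (n.factorial : ℂ)) * z ^ n := by
  have h1 : Filter.Tendsto (fun n : ℕ => (a + 1 * n) / (b + 1 * n)) Filter.atTop
      (nhds (1 / 1 : ℂ)) := tendsto_add_mul_div_add_mul_atTop_nhds a b 1 one_ne_zero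
  have h2 : Filter.Tendsto (fun n : ℕ => (1 : ℂ) / ((n : ℂ) + 1)) Filter.atTop (nhds 0) :=
    tendsto_one_div_add_atTop_nhds_zero_nat
  have h3 := ((h1.mul h2).mul_const z).norm
  simp only [mul_zero, zero_mul, norm_zero] at h3
  refine summable_of_ratio_norm_eventually_le (r := 1 / 2) (by norm_num) ?_
  filter_upwards [h3.eventually_le_const (by norm_num : (0 : ℝ) < 1 / 2)] with n hn
  refine le_of_eq_of_le ?_ (mul_le_mul_of_nonneg_right hn (norm_nonneg _))
  rw [← norm_mul, ascPochhammer_succ_eval, ascPochhammer_succ_eval, Nat.factorial_succ]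
  congr 1
  push_cast
  simp only [div_eq_mul_inv, mul_inv, one_mul]
  ring

theorem hasSum_kummerPhi (a b z : ℂ) :
    HasSum (fun n : ℕ => (ascPochhammer ℂ n).eval a /
      ((ascPochhammer ℂ n).eval b * (n.factorial : ℂ)) * z ^ n) (kummerPhi a b z) :=
  (summable_kummerPhi a b z).hasSum

theorem kummerPhi_add_one_sub_kummerPhi (a : ℂ) {b : ℂ} (hb : 0 < b.re) (z : ℂ) :
    kummerPhi (a + 1) b z - kummerPhi a b z = z / b * kummerPhi (a + 1) (b + 1) z := by
  have h := (hasSum_kummerPhi (a + 1) b z).sub (hasSum_kummerPhi a b z)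
  have hb' : 0 < (b + 1).re := by simpa using by linarith
  refine h.unique ?_
  rw [← hasSum_nat_add_iff' 1]
  simp only [Finset.range_one, Finset.sum_singleton, ascPochhammer_zero, Polynomial.eval_one,
    sub_self, sub_zero]
  have e : (fun n : ℕ => (ascPochhammer ℂ (n + 1)).eval (a + 1) /
        ((ascPochhammer ℂ (n + 1)).eval b * ((n + 1).factorial : ℂ)) * z ^ (n + 1) -
      (ascPochhammer ℂ (n + 1)).eval a /
        ((ascPochhammer ℂ (n + 1)).eval b * ((n + 1).factorial : ℂ)) * z ^ (n + 1)) =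
      fun n : ℕ => z / b * ((ascPochhammer ℂ n).eval (a + 1) /
        ((ascPochhammer ℂ n).eval (b + 1) * (n.factorial : ℂ)) * z ^ n) := by
    funext n
    have h1 := ascPochhammer_eval_ne_zero_of_re_pos hb' n
    have h2 : b ≠ 0 := by rintro rfl; simp at hb
    have h3 : (n.factorial : ℂ) ≠ 0 := Nat.cast_ne_zero.2 n.factorial_ne_zero
    have h4 : (n : ℂ) + 1 ≠ 0 := Nat.cast_add_one_ne_zero n
    rw [ascPochhammer_succ_eval n (a + 1), ascPochhammer_succ_eval_left a,
      ascPochhammer_succ_eval_left b, Nat.factorial_succ]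
    push_cast
    field_simp
    ring
  rw [e]
  exact (hasSum_kummerPhi _ _ _).mul_left _

theorem mul_kummerPhi_eq_sub (a : ℂ) {b : ℂ} (hb : 0 < b.re) (z : ℂ) :
    b * kummerPhi a b z = a * kummerPhi (a + 1) (b + 1) z - (a - b) * kummerPhi a (b + 1) z := by
  have h := ((hasSum_kummerPhi (a + 1) (b + 1) z).mul_left a).sub
    ((hasSum_kummerPhi a (b + 1) z).mul_left (a - b))
  have hb' : 0 < (b + 1).re := by simpa using by linarith
  refine HasSum.unique ?_ h
  have e : (fun n : ℕ => a * ((ascPochhammer ℂ n).eval (a + 1) /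
        ((ascPochhammer ℂ n).eval (b + 1) * (n.factorial : ℂ)) * z ^ n) -
      (a - b) * ((ascPochhammer ℂ n).eval a /
        ((ascPochhammer ℂ n).eval (b + 1) * (n.factorial : ℂ)) * z ^ n)) =
      fun n : ℕ => b * ((ascPochhammer ℂ n).eval a /
        ((ascPochhammer ℂ n).eval b * (n.factorial : ℂ)) * z ^ n) := by
    funext n
    have h1 := ascPochhammer_eval_ne_zero_of_re_pos hb' n
    have h2 := ascPochhammer_eval_ne_zero_of_re_pos hb n
    have h3 : (n.factorial : ℂ) ≠ 0 := Nat.cast_ne_zero.2 n.factorial_ne_zero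
    have ha := ascPochhammer_succ_eval_left a n
    have hb := ascPochhammer_succ_eval_left b n
    rw [ascPochhammer_succ_eval] at ha hb
    rw [← mul_assoc, ← mul_div_assoc, ← ha]
    field_simp
    linear_combination (z ^ n * (ascPochhammer ℂ n).eval a) * hb
  rw [e]
  exact (hasSum_kummerPhi _ _ _).mul_left _

theorem two_cpow_half : (2 : ℂ) ^ (1 / 2 : ℂ) = (√2 : ℝ) := by
  rw [Real.sqrt_eq_rpow, Complex.ofReal_cpow zero_le_two]
  push_cast
  rfl

theorem ofReal_sqrt_two_sq : ((√2 : ℝ) : ℂ) ^ 2 = 2 := by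
  rw [← Complex.ofReal_pow, Real.sq_sqrt zero_le_two, Complex.ofReal_ofNat]

theorem gamma_half : Complex.Gamma (1 / 2) = (√Real.pi : ℝ) := by
  have h := Complex.Gamma_ofReal (1 / 2)
  rw [Real.Gamma_one_half_eq] at h
  rw [← h]
  push_cast
  rfl

theorem gamma_neg_half : Complex.Gamma (-1 / 2) = -2 * (√Real.pi : ℝ) := by
  have h := Complex.Gamma_add_one (-1 / 2) (by norm_num)
  rw [show (-1 / 2 + 1 : ℂ) = 1 / 2 by norm_num, gamma_half] at h
  rw [h]
  ring

theorem parabolicCylinderD_neg_two_mul (a z : ℂ) :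
    parabolicCylinderD (-2 * a) z = 2 ^ (-a) * Complex.exp (-z ^ 2 / 4) * (√Real.pi : ℝ) *
      (kummerPhi a (1 / 2) (z ^ 2 / 2) / Complex.Gamma (a + 1 / 2) -
        (√2 : ℝ) * z * kummerPhi (a + 1 / 2) (3 / 2) (z ^ 2 / 2) / Complex.Gamma a) := by
  have h2 : ((√2 : ℝ) : ℂ) ≠ 0 := Complex.ofReal_ne_zero.2 (by positivity)
  rw [parabolicCylinderD, gamma_half, gamma_neg_half, two_cpow_half]
  rw [show -2 * a / 2 = -a by ring, show (1 - -2 * a) / 2 = a + 1 / 2 by ring,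
    show -(-2 * a) / 2 = a by ring]
  have e : z / ((√2 : ℝ) : ℂ) * 2 = (√2 : ℝ) * z := by
    field_simp
    rw [ofReal_sqrt_two_sq]
  rw [← e]
  ring

/-- The recurrence `D_{ν+1} = z D_ν - ν D_{ν-1}` at `ν = -2a`. The even and the odd part in `z` are
the two contiguous relations for Kummer's function above. -/
theorem parabolicCylinderD_recurrence {a : ℂ} (ha : 0 < a.re) (z : ℂ) :
    parabolicCylinderD (-2 * (a - 1 / 2)) z = z * parabolicCylinderD (-2 * a) z +
      2 * a * parabolicCylinderD (-2 * (a + 1 / 2)) z := by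
  have h2 : ((√2 : ℝ) : ℂ) ≠ 0 := Complex.ofReal_ne_zero.2 (by positivity)
  have ha0 : a ≠ 0 := by rintro rfl; simp at ha
  have e1 := kummerPhi_add_one_sub_kummerPhi (a - 1 / 2) (b := 1 / 2) (by norm_num) (z ^ 2 / 2)
  have e2 := mul_kummerPhi_eq_sub a (b := 1 / 2) (by norm_num) (z ^ 2 / 2)
  rw [show (1 / 2 + 1 : ℂ) = 3 / 2 by norm_num] at e1 e2
  rw [show a - 1 / 2 + 1 = a + 1 / 2 by ring] at e1
  have hG := Complex.one_div_Gamma_eq_self_mul_one_div_Gamma_add_one (a - 1 / 2)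
  rw [show a - 1 / 2 + 1 = a + 1 / 2 by ring] at hG
  have hg1 : Complex.Gamma a ≠ 0 := Complex.Gamma_ne_zero_of_re_pos ha
  have hg2 : Complex.Gamma (a + 1 / 2) ≠ 0 :=
    Complex.Gamma_ne_zero_of_re_pos (by rw [Complex.add_re]; norm_num; linarith)
  rw [parabolicCylinderD_neg_two_mul, parabolicCylinderD_neg_two_mul,
    parabolicCylinderD_neg_two_mul, show -(a - 1 / 2) = -a + 1 / 2 by ring,
    show -(a + 1 / 2) = -a - 1 / 2 by ring, Complex.cpow_add _ _ two_ne_zero,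
    Complex.cpow_sub _ _ two_ne_zero, two_cpow_half, show a - 1 / 2 + 1 / 2 = a by ring,
    show a + 1 / 2 + 1 / 2 = a + 1 by ring, Complex.Gamma_add_one a ha0,
    div_eq_mul_inv _ (Complex.Gamma (a - 1 / 2)), hG]
  have hs := ofReal_sqrt_two_sq
  generalize ((√2 : ℝ) : ℂ) = r at *
  generalize kummerPhi (a - 1 / 2) (1 / 2) (z ^ 2 / 2) = k1 at *
  have e1' : k1 = kummerPhi (a + 1 / 2) (1 / 2) (z ^ 2 / 2) -
      z ^ 2 * kummerPhi (a + 1 / 2) (3 / 2) (z ^ 2 / 2) := by linear_combination -e1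
  have e2' : kummerPhi a (1 / 2) (z ^ 2 / 2) = 2 * a * kummerPhi (a + 1) (3 / 2) (z ^ 2 / 2) -
      (2 * a - 1) * kummerPhi a (3 / 2) (z ^ 2 / 2) := by linear_combination 2 * e2
  rw [e1', e2']
  generalize kummerPhi (a + 1 / 2) (3 / 2) (z ^ 2 / 2) = k2 at *
  field_simp
  simp only [hs]
  linear_combination (2 * z ^ 2 * k2) * hs

/-! ### Laplace-type integral for parabolic cylinder functions -/

theorem factorial_two_mul_eq (k : ℕ) :
    ((2 * k).factorial : ℂ) = 4 ^ k * ((ascPochhammer ℂ k).eval (1 / 2) * k.factorial) := by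
  induction k with
  | zero => simp
  | succ k ih =>
    rw [show 2 * (k + 1) = 2 * k + 1 + 1 by ring, Nat.factorial_succ, Nat.factorial_succ,
      Nat.factorial_succ, ascPochhammer_succ_eval]
    push_cast
    rw [ih]
    ring

theorem factorial_two_mul_add_one_eq (k : ℕ) :
    ((2 * k + 1).factorial : ℂ) = 4 ^ k * ((ascPochhammer ℂ k).eval (3 / 2) * k.factorial) := by
  induction k with
  | zero => simp
  | succ k ih =>
    rw [show 2 * (k + 1) + 1 = 2 * k + 1 + 1 + 1 by ring, Nat.factorial_succ, Nat.factorial_succ,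
      Nat.factorial_succ k, ascPochhammer_succ_eval]
    push_cast
    rw [ih]
    ring

theorem hasSum_pow_div_factorial_mul_gamma {a : ℂ} (ha : 0 < a.re) (w : ℂ) :
    HasSum (fun n : ℕ => w ^ n / n.factorial * Complex.Gamma (a + n / 2))
      (Complex.Gamma a * kummerPhi a (1 / 2) (w ^ 2 / 4) +
        w * Complex.Gamma (a + 1 / 2) * kummerPhi (a + 1 / 2) (3 / 2) (w ^ 2 / 4)) := by
  refine HasSum.even_add_odd ?_ ?_
  · have h := (hasSum_kummerPhi a (1 / 2) (w ^ 2 / 4)).mul_left (Complex.Gamma a)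
    refine h.congr_fun fun k => ?_
    rw [factorial_two_mul_eq, show a + ((2 * k : ℕ) : ℂ) / 2 = a + k by push_cast; ring,
      gamma_add_natCast ha, pow_mul, div_pow]
    simp only [div_eq_mul_inv, mul_inv]
    ring
  · have h := (hasSum_kummerPhi (a + 1 / 2) (3 / 2) (w ^ 2 / 4)).mul_left
      (w * Complex.Gamma (a + 1 / 2))
    refine h.congr_fun fun k => ?_
    rw [factorial_two_mul_add_one_eq,
      show a + ((2 * k + 1 : ℕ) : ℂ) / 2 = a + 1 / 2 + k by push_cast; ring,
      gamma_add_natCast (by rw [Complex.add_re]; norm_num; linarith), pow_succ, pow_mul, div_pow]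
    simp only [div_eq_mul_inv, mul_inv]
    ring

open MeasureTheory Set in
theorem integrableOn_cpow_mul_exp_neg {a : ℂ} (ha : 0 < a.re) :
    IntegrableOn (fun t : ℝ => (t : ℂ) ^ (a - 1) * Complex.exp (-t)) (Ioi 0) := by
  refine (Complex.GammaIntegral_convergent ha).congr_fun (fun t _ => ?_) measurableSet_Ioi
  simp [mul_comm]

open MeasureTheory Set in
theorem setIntegral_cpow_mul_exp_neg {a : ℂ} (ha : 0 < a.re) :
    ∫ t in Ioi (0 : ℝ), (t : ℂ) ^ (a - 1) * Complex.exp (-t) = Complex.Gamma a := by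
  simpa using Complex.integral_cpow_mul_exp_neg_mul_Ioi ha one_pos

open MeasureTheory Set in
theorem setIntegral_norm_cpow_mul_exp_neg {a : ℂ} (ha : 0 < a.re) :
    ((∫ t in Ioi (0 : ℝ), ‖(t : ℂ) ^ (a - 1) * Complex.exp (-t)‖ : ℝ) : ℂ) =
      Complex.Gamma a.re := by
  rw [← setIntegral_cpow_mul_exp_neg (by simpa using ha), ← integral_complex_ofReal]
  refine setIntegral_congr_fun measurableSet_Ioi fun t ht => ?_
  simp only [norm_mul, Complex.norm_cpow_eq_rpow_re_of_pos ht, Complex.norm_exp, Complex.sub_re,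
    Complex.one_re, Complex.neg_re, Complex.ofReal_re]
  push_cast [Complex.ofReal_cpow (le_of_lt ht)]
  rfl

open MeasureTheory Set in
/-- Expand `e^{-x √(2τ)}` in powers of `√τ` and integrate term by term; the even and odd terms
form the two Kummer series of the parabolic cylinder function. -/
theorem integral_cpow_mul_exp_neg_mul_exp_neg_sqrt {a : ℂ} (ha : 0 < a.re) (x : ℝ) :
    ∫ τ in Ioi (0 : ℝ), (τ : ℂ) ^ (a - 1) * Complex.exp (-τ) *
        ((Real.exp (-(x * √(2 * τ))) : ℝ) : ℂ) =
      Complex.Gamma a * kummerPhi a (1 / 2) ((x : ℂ) ^ 2 / 2) -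
        (√2 : ℝ) * x * Complex.Gamma (a + 1 / 2) *
          kummerPhi (a + 1 / 2) (3 / 2) ((x : ℂ) ^ 2 / 2) := by
  set w : ℂ := -((√2 : ℝ) * x) with hw
  have hw2 : w ^ 2 / 4 = (x : ℂ) ^ 2 / 2 := by
    rw [hw, neg_sq, mul_pow, ofReal_sqrt_two_sq]; ring
  set F : ℕ → ℝ → ℂ := fun n τ => w ^ n / n.factorial *
    ((τ : ℂ) ^ (a + n / 2 - 1) * Complex.exp (-τ)) with hF
  have hre (n : ℕ) : (a + n / 2).re = a.re + n / 2 := by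
    rw [Complex.add_re]
    norm_num
  have han (n : ℕ) : 0 < (a + n / 2).re := by rw [hre]; positivity
  have hint (n : ℕ) : Integrable (F n) (volume.restrict (Ioi 0)) :=
    (integrableOn_cpow_mul_exp_neg (han n)).const_mul _
  have hsum : Summable fun n => ∫ τ in Ioi (0 : ℝ), ‖F n τ‖ := by
    have hs := (hasSum_pow_div_factorial_mul_gamma (a := (a.re : ℂ)) (by simpa using ha)
      w).summable.norm
    refine Summable.of_nonneg_of_le (fun n => integral_nonneg fun _ => norm_nonneg _)
      (fun n => ?_) hs
    simp only [hF, norm_mul _ (_ * _)]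
    rw [integral_const_mul, norm_mul]
    refine mul_le_mul_of_nonneg_left ?_ (norm_nonneg _)
    have h2 := setIntegral_norm_cpow_mul_exp_neg (han n)
    rw [hre] at h2
    push_cast at h2
    rw [← h2, Complex.norm_real]
    exact le_abs_self _
  have hmain := hasSum_integral_of_summable_integral_norm hint hsum
  have hterm (n : ℕ) : ∫ τ in Ioi (0 : ℝ), F n τ =
      w ^ n / n.factorial * Complex.Gamma (a + n / 2) := by
    simp only [hF]
    rw [integral_const_mul, setIntegral_cpow_mul_exp_neg (han n)]
  have hpt : ∫ τ in Ioi (0 : ℝ), ∑' n, F n τ = ∫ τ in Ioi (0 : ℝ), (τ : ℂ) ^ (a - 1) *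
      Complex.exp (-τ) * ((Real.exp (-(x * √(2 * τ))) : ℝ) : ℂ) := by
    refine setIntegral_congr_fun measurableSet_Ioi fun τ hτ => ?_
    have hτ0 : (0 : ℝ) < τ := hτ
    have h := (NormedSpace.expSeries_div_hasSum_exp (w * (√τ : ℝ))).mul_left
      ((τ : ℂ) ^ (a - 1) * Complex.exp (-τ))
    rw [← Complex.exp_eq_exp_ℂ] at h
    have e : w * (√τ : ℝ) = ((-(x * √(2 * τ)) : ℝ) : ℂ) := by
      rw [hw, Real.sqrt_mul zero_le_two]; push_cast; ring
    have e2 : (fun n : ℕ => (τ : ℂ) ^ (a - 1) * Complex.exp (-τ) *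
        ((w * (√τ : ℝ)) ^ n / n.factorial)) = fun n => F n τ := by
      funext n
      have hn : (τ : ℂ) ^ ((n : ℂ) / 2) = ((√τ : ℝ) : ℂ) ^ n := by
        rw [Real.sqrt_eq_rpow, Complex.ofReal_cpow hτ0.le, ← Complex.cpow_mul_nat]
        congr 1
        push_cast
        ring
      simp only [hF]
      rw [add_sub_right_comm, Complex.cpow_add _ _ (Complex.ofReal_ne_zero.2 hτ0.ne'), hn, mul_pow]
      ring
    rw [e2, e, ← Complex.ofReal_exp] at h
    exact h.tsum_eq
  rw [hpt] at hmain
  simp only [hterm] at hmain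
  rw [hmain.unique (hasSum_pow_div_factorial_mul_gamma ha w), hw2, hw]
  ring

open MeasureTheory Set in
theorem parabolicCylinderD_eq_integral_exp_neg_sqrt {a : ℂ} (ha : 0 < a.re) (x : ℝ) :
    parabolicCylinderD (-2 * a) x = 2 ^ (-a) * Complex.exp (-(x : ℂ) ^ 2 / 4) * (√Real.pi : ℝ) /
      (Complex.Gamma a * Complex.Gamma (a + 1 / 2)) *
      ∫ τ in Ioi (0 : ℝ), (τ : ℂ) ^ (a - 1) * Complex.exp (-τ) *
        ((Real.exp (-(x * √(2 * τ))) : ℝ) : ℂ) := by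
  have hg1 : Complex.Gamma a ≠ 0 := Complex.Gamma_ne_zero_of_re_pos ha
  have hg2 : Complex.Gamma (a + 1 / 2) ≠ 0 :=
    Complex.Gamma_ne_zero_of_re_pos (by rw [Complex.add_re]; norm_num; linarith)
  rw [integral_cpow_mul_exp_neg_mul_exp_neg_sqrt ha x, parabolicCylinderD_neg_two_mul]
  generalize Complex.Gamma (a + 1 / 2) = g at *
  generalize kummerPhi (a + 1 / 2) (3 / 2) ((x : ℂ) ^ 2 / 2) = k at *
  field_simp

/-! ### Subordination integrals for the exponential -/

open MeasureTheory Set Filter Topology in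
theorem integral_Ioi_zero_of_hasDerivAt_of_nonneg_of_tendsto {g g' : ℝ → ℝ} {l m : ℝ}
    (hderiv : ∀ x ∈ Ioi (0 : ℝ), HasDerivAt g (g' x) x) (hpos : ∀ x ∈ Ioi (0 : ℝ), 0 ≤ g' x)
    (h0 : Tendsto g (𝓝[>] 0) (𝓝 l)) (hinf : Tendsto g atTop (𝓝 m)) :
    IntegrableOn g' (Ioi 0) ∧ ∫ x in Ioi (0 : ℝ), g' x = m - l := by
  have hcont : ContinuousWithinAt (Function.update g 0 l) (Ici 0) 0 := by
    rw [continuousWithinAt_update_same, Ici_sdiff_left]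
    exact h0
  have hd : ∀ x ∈ Ioi (0 : ℝ), HasDerivAt (Function.update g 0 l) (g' x) x := fun x hx =>
    (hderiv x hx).congr_of_eventuallyEq <| by
      filter_upwards [Ioi_mem_nhds hx] with y hy
      exact Function.update_of_ne (ne_of_gt hy) _ _
  have hl : Tendsto (Function.update g 0 l) atTop (𝓝 m) := hinf.congr' <| by
    filter_upwards [Ioi_mem_atTop 0] with y hy
    exact (Function.update_of_ne (ne_of_gt hy) _ _).symm
  refine ⟨integrableOn_Ioi_deriv_of_nonneg hcont hd hpos hl, ?_⟩
  rw [integral_Ioi_of_hasDerivAt_of_nonneg hcont hd hpos hl, Function.update_self]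

/-- The unnormalised error function `∫₀ʷ exp (-v²) dv`. -/
noncomputable def gaussPrimitive (w : ℝ) : ℝ := ∫ v in (0 : ℝ)..w, Real.exp (-v ^ 2)

theorem hasDerivAt_gaussPrimitive (w : ℝ) :
    HasDerivAt gaussPrimitive (Real.exp (-w ^ 2)) w := by
  have hc : Continuous fun v : ℝ => Real.exp (-v ^ 2) := by fun_prop
  exact intervalIntegral.integral_hasDerivAt_right (hc.intervalIntegrable _ _)
    (hc.stronglyMeasurableAtFilter _ _) hc.continuousAt

open MeasureTheory Filter Topology in
theorem tendsto_gaussPrimitive_atTop :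
    Tendsto gaussPrimitive atTop (𝓝 (√Real.pi / 2)) := by
  have h1 : Integrable fun v : ℝ => Real.exp (-v ^ 2) := by
    simpa using integrable_exp_neg_mul_sq one_pos
  have h2 := intervalIntegral_tendsto_integral_Ioi (0 : ℝ) h1.integrableOn tendsto_id
  have h3 := integral_gaussian_Ioi 1
  simp only [neg_mul, one_mul, div_one] at h3
  rwa [h3] at h2

theorem gaussPrimitive_neg (w : ℝ) : gaussPrimitive (-w) = -gaussPrimitive w := by
  have h := intervalIntegral.integral_comp_neg (a := 0) (b := w) fun v : ℝ => Real.exp (-v ^ 2)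
  simp only [neg_sq, neg_zero] at h
  rw [gaussPrimitive, gaussPrimitive, h, intervalIntegral.integral_symm]

open Filter Topology in
theorem tendsto_gaussPrimitive_atBot :
    Tendsto gaussPrimitive atBot (𝓝 (-(√Real.pi / 2))) := by
  have h := (tendsto_gaussPrimitive_atTop.comp tendsto_neg_atBot_atTop).neg
  refine h.congr fun w => ?_
  simp [gaussPrimitive_neg]

theorem hasDerivAt_gaussPrimitive_sqrt_sub (q : ℝ) {u : ℝ} (hu : 0 < u) :
    HasDerivAt (fun u => Real.exp (-2 * q) * gaussPrimitive (√u - q / √u))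
      (Real.exp (-u - q ^ 2 / u) * ((1 + q / u) / (2 * √u))) u := by
  have hs : 0 < √u := Real.sqrt_pos.2 hu
  have hs2 : √u ^ 2 = u := Real.sq_sqrt hu.le
  have h1 := Real.hasDerivAt_sqrt hu.ne'
  have h2 : HasDerivAt (fun u => √u - q / √u) ((1 + q / u) / (2 * √u)) u := by
    refine (h1.sub ((h1.inv hs.ne').const_mul q)).congr_deriv ?_
    rw [hs2]
    field_simp
    ring
  have h3 := ((hasDerivAt_gaussPrimitive (√u - q / √u)).comp u h2).const_mul (Real.exp (-2 * q))
  refine h3.congr_deriv (Eq.symm ?_)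
  rw [← mul_assoc, ← Real.exp_add]
  congr 2
  have : (√u - q / √u) ^ 2 = u - 2 * q + q ^ 2 / u := by
    rw [sub_sq, div_pow, hs2]
    field_simp
  rw [this]
  ring

open Filter Topology in
theorem tendsto_gaussPrimitive_sqrt_sub_atTop (q : ℝ) :
    Tendsto (fun u => Real.exp (-2 * q) * gaussPrimitive (√u - q / √u)) atTop
      (𝓝 (Real.exp (-2 * q) * (√Real.pi / 2))) := by
  refine (tendsto_gaussPrimitive_atTop.comp ?_).const_mul _
  have h : Tendsto (fun u : ℝ => -(q / √u)) atTop (𝓝 (-0)) :=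
    (tendsto_const_nhds.div_atTop Real.tendsto_sqrt_atTop).neg
  simpa only [sub_eq_add_neg] using Real.tendsto_sqrt_atTop.atTop_add h

open Filter Topology in
theorem tendsto_sqrt_nhdsGT_zero : Tendsto (fun u : ℝ => √u) (𝓝[>] 0) (𝓝[>] 0) := by
  refine tendsto_nhdsWithin_iff.2 ⟨?_, ?_⟩
  · simpa using (Real.continuous_sqrt.tendsto 0).mono_left nhdsWithin_le_nhds
  · filter_upwards [self_mem_nhdsWithin] with u hu
    exact Real.sqrt_pos.2 hu

open Filter Topology in
theorem tendsto_gaussPrimitive_sqrt_sub_nhdsGT {q : ℝ} (hq : 0 < q) :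
    Tendsto (fun u => Real.exp (-2 * q) * gaussPrimitive (√u - q / √u)) (𝓝[>] 0)
      (𝓝 (Real.exp (-2 * q) * -(√Real.pi / 2))) := by
  refine (tendsto_gaussPrimitive_atBot.comp ?_).const_mul _
  have h1 : Tendsto (fun u : ℝ => √u) (𝓝[>] 0) (𝓝 0) :=
    tendsto_sqrt_nhdsGT_zero.mono_right nhdsWithin_le_nhds
  have h2 : Tendsto (fun u : ℝ => -(q * (√u)⁻¹)) (𝓝[>] 0) atBot :=
    tendsto_neg_atTop_atBot.comp
      ((tendsto_inv_nhdsGT_zero.comp tendsto_sqrt_nhdsGT_zero).const_mul_atTop hq)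
  simpa only [sub_eq_add_neg, div_eq_mul_inv] using h1.add_atBot h2

open Filter Topology in
theorem tendsto_gaussPrimitive_sqrt_sub_neg_nhdsGT {q : ℝ} (hq : 0 < q) :
    Tendsto (fun u => Real.exp (-2 * -q) * gaussPrimitive (√u - -q / √u)) (𝓝[>] 0)
      (𝓝 (Real.exp (-2 * -q) * (√Real.pi / 2))) := by
  refine (tendsto_gaussPrimitive_atTop.comp ?_).const_mul _
  have h1 : Tendsto (fun u : ℝ => √u) (𝓝[>] 0) (𝓝 0) :=
    tendsto_sqrt_nhdsGT_zero.mono_right nhdsWithin_le_nhds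
  have h2 : Tendsto (fun u : ℝ => q * (√u)⁻¹) (𝓝[>] 0) atTop :=
    (tendsto_inv_nhdsGT_zero.comp tendsto_sqrt_nhdsGT_zero).const_mul_atTop hq
  simpa only [sub_eq_add_neg, div_eq_mul_inv, neg_mul, neg_neg] using h1.add_atTop h2

open MeasureTheory Set in
/-- With `G` the Gaussian primitive, `e^{∓2q} G(√u ∓ q/√u)` have derivatives
`e^{-u-q²/u} (1 ± q/u) / (2√u)`; their sum is an antiderivative of the integrand. -/
theorem integral_exp_neg_sub_div_sqrt {q : ℝ} (hq : 0 < q) :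
    IntegrableOn (fun u : ℝ => Real.exp (-u - q ^ 2 / u) / √u) (Ioi 0) ∧
      ∫ u in Ioi (0 : ℝ), Real.exp (-u - q ^ 2 / u) / √u = √Real.pi * Real.exp (-2 * q) := by
  have h := integral_Ioi_zero_of_hasDerivAt_of_nonneg_of_tendsto
    (g' := fun u : ℝ => Real.exp (-u - q ^ 2 / u) / √u)
    (fun u hu => ?_) (fun u hu => by positivity)
    ((tendsto_gaussPrimitive_sqrt_sub_nhdsGT hq).add
      (tendsto_gaussPrimitive_sqrt_sub_neg_nhdsGT hq))
    ((tendsto_gaussPrimitive_sqrt_sub_atTop q).add (tendsto_gaussPrimitive_sqrt_sub_atTop (-q)))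
  · refine ⟨h.1, h.2.trans ?_⟩
    ring
  · have hu' : (0 : ℝ) < u := hu
    refine ((hasDerivAt_gaussPrimitive_sqrt_sub q hu).add
      (hasDerivAt_gaussPrimitive_sqrt_sub (-q) hu)).congr_deriv ?_
    rw [neg_sq]
    field_simp
    ring

open MeasureTheory Set in
/-- The difference of the two antiderivatives used in `integral_exp_neg_sub_div_sqrt` gives the
companion integral. -/
theorem integral_exp_neg_sub_div_mul_sqrt {q : ℝ} (hq : 0 < q) :
    IntegrableOn (fun u : ℝ => q * Real.exp (-u - q ^ 2 / u) / (u * √u)) (Ioi 0) ∧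
      ∫ u in Ioi (0 : ℝ), q * Real.exp (-u - q ^ 2 / u) / (u * √u) =
        √Real.pi * Real.exp (-2 * q) := by
  have h := integral_Ioi_zero_of_hasDerivAt_of_nonneg_of_tendsto
    (g' := fun u : ℝ => q * Real.exp (-u - q ^ 2 / u) / (u * √u))
    (fun u hu => ?_) (fun u hu => by have := mem_Ioi.1 hu; positivity)
    ((tendsto_gaussPrimitive_sqrt_sub_nhdsGT hq).sub
      (tendsto_gaussPrimitive_sqrt_sub_neg_nhdsGT hq))
    ((tendsto_gaussPrimitive_sqrt_sub_atTop q).sub (tendsto_gaussPrimitive_sqrt_sub_atTop (-q)))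
  · refine ⟨h.1, h.2.trans ?_⟩
    ring
  · have hu' : (0 : ℝ) < u := hu
    refine ((hasDerivAt_gaussPrimitive_sqrt_sub q hu).sub
      (hasDerivAt_gaussPrimitive_sqrt_sub (-q) hu)).congr_deriv ?_
    rw [neg_sq]
    field_simp
    ring

/-! ### Tricomi-type integrals for parabolic cylinder functions -/

theorem ofReal_mul_cpow {p q : ℝ} (hp : 0 ≤ p) (hq : 0 ≤ q) (s : ℂ) :
    ((p * q : ℝ) : ℂ) ^ s = (p : ℂ) ^ s * (q : ℂ) ^ s := by
  rw [Complex.ofReal_mul, Complex.mul_cpow_ofReal_nonneg hp hq]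

theorem ofReal_inv_cpow {p : ℝ} (hp : 0 ≤ p) (s : ℂ) :
    ((p⁻¹ : ℝ) : ℂ) ^ s = (p : ℂ) ^ (-s) := by
  rw [Complex.cpow_neg, Complex.ofReal_inv, Complex.inv_cpow]
  rw [Complex.arg_ofReal_of_nonneg hp]
  exact Real.pi_ne_zero.symm

theorem ofReal_div_cpow {p q : ℝ} (hp : 0 ≤ p) (hq : 0 ≤ q) (s : ℂ) :
    ((p / q : ℝ) : ℂ) ^ s = (p : ℂ) ^ s * (q : ℂ) ^ (-s) := by
  rw [div_eq_mul_inv, ofReal_mul_cpow hp (inv_nonneg.2 hq), ofReal_inv_cpow hq]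

theorem ofReal_sqrt_eq_cpow {u : ℝ} (hu : 0 ≤ u) : ((√u : ℝ) : ℂ) = (u : ℂ) ^ (1 / 2 : ℂ) := by
  rw [Real.sqrt_eq_rpow, Complex.ofReal_cpow hu]
  push_cast
  rfl

open MeasureTheory Set in
/-- Fubini's theorem for a complex weight and a nonnegative kernel with known mass. -/
theorem integral_weight_mul_kernel_swap {f : ℝ → ℂ} {k : ℝ → ℝ → ℝ} {h : ℝ → ℝ}
    (hf : IntegrableOn f (Ioi 0)) (hk : Measurable (Function.uncurry k))
    (hk0 : ∀ τ ∈ Ioi (0 : ℝ), ∀ u ∈ Ioi (0 : ℝ), 0 ≤ k τ u)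
    (hki : ∀ τ ∈ Ioi (0 : ℝ), IntegrableOn (k τ) (Ioi 0))
    (hh : ∀ τ ∈ Ioi (0 : ℝ), ∫ u in Ioi (0 : ℝ), k τ u = h τ)
    (hfh : IntegrableOn (fun τ => f τ * (h τ : ℂ)) (Ioi 0)) :
    IntegrableOn (fun u => ∫ τ in Ioi (0 : ℝ), f τ * (k τ u : ℂ)) (Ioi 0) ∧
      ∫ τ in Ioi (0 : ℝ), f τ * (h τ : ℂ) =
        ∫ u in Ioi (0 : ℝ), ∫ τ in Ioi (0 : ℝ), f τ * (k τ u : ℂ) := by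
  have hh0 (τ : ℝ) (hτ : τ ∈ Ioi (0 : ℝ)) : 0 ≤ h τ := by
    rw [← hh τ hτ]
    exact setIntegral_nonneg measurableSet_Ioi (hk0 τ hτ)
  have hint : Integrable (Function.uncurry fun τ u => f τ * (k τ u : ℂ))
      ((volume.restrict (Ioi 0)).prod (volume.restrict (Ioi 0))) := by
    have hm : AEStronglyMeasurable (Function.uncurry fun τ u => f τ * (k τ u : ℂ))
        ((volume.restrict (Ioi (0 : ℝ))).prod (volume.restrict (Ioi (0 : ℝ)))) := by
      have h1 : AEStronglyMeasurable (fun p : ℝ × ℝ => f p.1)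
          ((volume.restrict (Ioi (0 : ℝ))).prod (volume.restrict (Ioi (0 : ℝ)))) :=
        hf.aestronglyMeasurable.comp_fst
      have h2 : AEStronglyMeasurable (fun p : ℝ × ℝ => (k p.1 p.2 : ℂ))
          ((volume.restrict (Ioi (0 : ℝ))).prod (volume.restrict (Ioi (0 : ℝ)))) :=
        (Complex.measurable_ofReal.comp hk).aestronglyMeasurable
      exact h1.mul h2
    rw [integrable_prod_iff hm]
    refine ⟨?_, ?_⟩
    · filter_upwards [ae_restrict_mem measurableSet_Ioi] with τ hτ
      exact Integrable.const_mul (𝕜 := ℂ) (hki τ hτ).ofReal (f τ)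
    · refine hfh.norm.congr ?_
      filter_upwards [ae_restrict_mem measurableSet_Ioi] with τ hτ
      simp only [Function.uncurry, norm_mul]
      rw [integral_const_mul, Complex.norm_real, Real.norm_of_nonneg (hh0 τ hτ), ← hh τ hτ]
      congr 1
      refine setIntegral_congr_fun measurableSet_Ioi fun u hu => ?_
      simp only [Complex.norm_real, Real.norm_of_nonneg (hk0 τ hτ u hu)]
  refine ⟨hint.integral_prod_right, ?_⟩
  rw [← integral_integral_swap hint]
  refine setIntegral_congr_fun measurableSet_Ioi fun τ hτ => ?_
  rw [integral_const_mul, integral_complex_ofReal, hh τ hτ]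

/-- The integrand `u ^ (s - 1) e^{-u} (x² + 2u) ^ (-r)`, whose integral over `(0, ∞)` is, up to
elementary factors, Tricomi's confluent hypergeometric function of `x² / 2`. -/
noncomputable def tricomiIntegrand (s r : ℂ) (x u : ℝ) : ℂ :=
  (u : ℂ) ^ (s - 1) * Complex.exp (-u) * ((x ^ 2 + 2 * u : ℝ) : ℂ) ^ (-r)

open MeasureTheory Set in
theorem integral_cpow_mul_exp_neg_mul_exp_neg_div {s : ℂ} (hs : 0 < s.re) (x : ℝ) {u : ℝ}
    (hu : 0 < u) :
    ∫ τ in Ioi (0 : ℝ), (τ : ℂ) ^ (s - 1) * Complex.exp (-τ) *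
        ((Real.exp (-(x ^ 2 * τ / 2 / u)) : ℝ) : ℂ) =
      2 ^ s * (u : ℂ) ^ s * ((x ^ 2 + 2 * u : ℝ) : ℂ) ^ (-s) * Complex.Gamma s := by
  have hr : 0 < (x ^ 2 + 2 * u) / (2 * u) := by positivity
  have h := Complex.integral_cpow_mul_exp_neg_mul_Ioi hs hr
  have e : (1 / (((x ^ 2 + 2 * u) / (2 * u) : ℝ) : ℂ)) ^ s =
      2 ^ s * (u : ℂ) ^ s * ((x ^ 2 + 2 * u : ℝ) : ℂ) ^ (-s) := by
    rw [one_div, ← Complex.ofReal_inv, inv_div, ofReal_div_cpow (by positivity) (by positivity),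
      ofReal_mul_cpow zero_le_two hu.le, Complex.ofReal_ofNat]
  rw [e] at h
  rw [← h]
  refine setIntegral_congr_fun measurableSet_Ioi fun τ _ => ?_
  rw [mul_assoc, Complex.ofReal_exp, ← Complex.exp_add]
  congr 2
  have hu' : (u : ℂ) ≠ 0 := Complex.ofReal_ne_zero.2 hu.ne'
  push_cast
  field_simp
  ring

open MeasureTheory Set in
theorem integrableOn_cpow_mul_exp_neg_mul_exp_neg_sqrt {a : ℂ} (ha : 0 < a.re) {x : ℝ}
    (hx : 0 ≤ x) :
    IntegrableOn (fun τ : ℝ => (τ : ℂ) ^ (a - 1) * Complex.exp (-τ) *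
      ((Real.exp (-(x * √(2 * τ))) : ℝ) : ℂ)) (Ioi 0) := by
  refine (integrableOn_cpow_mul_exp_neg ha).mul_bdd (c := 1) ?_ (Filter.Eventually.of_forall ?_)
  · have : Continuous fun τ : ℝ => ((Real.exp (-(x * √(2 * τ))) : ℝ) : ℂ) := by fun_prop
    exact this.aestronglyMeasurable
  · intro τ
    rw [Complex.norm_real, Real.norm_of_nonneg (Real.exp_pos _).le, Real.exp_le_one_iff]
    simp only [Left.neg_nonpos_iff]
    positivity

theorem sq_mul_sqrt_two_mul_div_two (x : ℝ) {τ : ℝ} (hτ : 0 ≤ τ) :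
    (x * √(2 * τ) / 2) ^ 2 = x ^ 2 * τ / 2 := by
  rw [div_pow, mul_pow, Real.sq_sqrt (by positivity)]
  ring

open MeasureTheory Set in
/-- A kernel of mass `√π e^{-x √(2τ)}` converts the Laplace-type integral for `D` into an integral
of the function obtained by integrating out `τ`. -/
theorem parabolicCylinderD_eq_integral_of_kernel {a : ℂ} (ha : 0 < a.re) {x : ℝ} (hx : 0 ≤ x)
    {k : ℝ → ℝ → ℝ} (hk : Measurable (Function.uncurry k))
    (hk0 : ∀ τ ∈ Ioi (0 : ℝ), ∀ u ∈ Ioi (0 : ℝ), 0 ≤ k τ u)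
    (hki : ∀ τ ∈ Ioi (0 : ℝ), IntegrableOn (k τ) (Ioi 0) ∧
      ∫ u in Ioi (0 : ℝ), k τ u = √Real.pi * Real.exp (-(x * √(2 * τ))))
    {T : ℝ → ℂ} {C : ℂ} (hC : C ≠ 0)
    (hT : ∀ u ∈ Ioi (0 : ℝ), ∫ τ in Ioi (0 : ℝ), (τ : ℂ) ^ (a - 1) * Complex.exp (-τ) *
      (k τ u : ℂ) = C * T u) :
    IntegrableOn T (Ioi 0) ∧
      parabolicCylinderD (-2 * a) x = Complex.exp (-(x : ℂ) ^ 2 / 4) * C /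
        (2 ^ a * Complex.Gamma a * Complex.Gamma (a + 1 / 2)) * ∫ u in Ioi (0 : ℝ), T u := by
  have hpi : ((√Real.pi : ℝ) : ℂ) ≠ 0 := Complex.ofReal_ne_zero.2 (by positivity)
  have hswap := integral_weight_mul_kernel_swap
    (f := fun τ : ℝ => (τ : ℂ) ^ (a - 1) * Complex.exp (-τ))
    (integrableOn_cpow_mul_exp_neg ha) hk hk0 (fun τ hτ => (hki τ hτ).1)
    (fun τ hτ => (hki τ hτ).2)
    (IntegrableOn.congr_fun ((integrableOn_cpow_mul_exp_neg_mul_exp_neg_sqrt ha hx).const_mul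
      ((√Real.pi : ℝ) : ℂ)) (fun τ _ => by push_cast; ring) measurableSet_Ioi)
  refine ⟨?_, ?_⟩
  · exact (integrable_const_mul_iff hC.isUnit _).1 (hswap.1.congr_fun hT measurableSet_Ioi)
  · have h := hswap.2
    rw [setIntegral_congr_fun measurableSet_Ioi hT, integral_const_mul] at h
    have h' : ((√Real.pi : ℝ) : ℂ) * ∫ τ in Ioi (0 : ℝ), (τ : ℂ) ^ (a - 1) * Complex.exp (-τ) *
        ((Real.exp (-(x * √(2 * τ))) : ℝ) : ℂ) = C * ∫ u in Ioi (0 : ℝ), T u := by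
      rw [← h, ← integral_const_mul]
      refine setIntegral_congr_fun measurableSet_Ioi fun τ _ => ?_
      push_cast
      ring
    rw [parabolicCylinderD_eq_integral_exp_neg_sqrt ha x, Complex.cpow_neg]
    simp only [div_eq_mul_inv, mul_inv]
    linear_combination (((2 : ℂ) ^ a)⁻¹ * Complex.exp (-(x : ℂ) ^ 2 * 4⁻¹) *
      (Complex.Gamma a)⁻¹ * (Complex.Gamma (a + 1 * 2⁻¹))⁻¹) * h'

theorem two_cpow_ne_zero (s : ℂ) : (2 : ℂ) ^ s ≠ 0 := by simp [Complex.cpow_eq_zero_iff]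

theorem add_half_re_pos {a : ℂ} (ha : 0 < a.re) : 0 < (a + 1 / 2).re := by
  rw [Complex.add_re]; norm_num; linarith

open MeasureTheory Set in
/-- The kernel here is that of `integral_exp_neg_sub_div_mul_sqrt` with `q = x √(2τ) / 2`; it
vanishes at `x = 0`, which has to be excluded. -/
theorem parabolicCylinderD_eq_tricomi_add_half_right {a : ℂ} (ha : 0 < a.re) {x : ℝ}
    (hx : 0 < x) :
    IntegrableOn (tricomiIntegrand a (a + 1 / 2) x) (Ioi 0) ∧
      parabolicCylinderD (-2 * a) x = x * Complex.exp (-(x : ℂ) ^ 2 / 4) / Complex.Gamma a *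
        ∫ u in Ioi (0 : ℝ), tricomiIntegrand a (a + 1 / 2) x u := by
  have ha2 := add_half_re_pos ha
  have hg2 : Complex.Gamma (a + 1 / 2) ≠ 0 := Complex.Gamma_ne_zero_of_re_pos ha2
  have hx0 : (x : ℂ) ≠ 0 := Complex.ofReal_ne_zero.2 hx.ne'
  have hs2 : ((√2 : ℝ) : ℂ) ≠ 0 := Complex.ofReal_ne_zero.2 (by positivity)
  have h2a := two_cpow_ne_zero a
  have hmain := parabolicCylinderD_eq_integral_of_kernel ha hx.le
    (k := fun τ u => x * √(2 * τ) / 2 * Real.exp (-u - (x * √(2 * τ) / 2) ^ 2 / u) / (u * √u))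
    (T := tricomiIntegrand a (a + 1 / 2) x) (C := x * 2 ^ a * Complex.Gamma (a + 1 / 2))
    (by unfold Function.uncurry; fun_prop)
    (fun τ hτ u hu => by have := mem_Ioi.1 hτ; have := mem_Ioi.1 hu; positivity)
    (fun τ hτ => by
      have hτ' := mem_Ioi.1 hτ
      have h := integral_exp_neg_sub_div_mul_sqrt (q := x * √(2 * τ) / 2) (by positivity)
      rwa [show -2 * (x * √(2 * τ) / 2) = -(x * √(2 * τ)) by ring] at h)
    (mul_ne_zero (mul_ne_zero hx0 h2a) hg2) ?_
  · refine ⟨hmain.1, hmain.2.trans ?_⟩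
    generalize Complex.Gamma (a + 1 / 2) = g at *
    congr 1
    field_simp
  · intro u hu
    have hu' : (0 : ℝ) < u := hu
    have hu0 : (u : ℂ) ≠ 0 := Complex.ofReal_ne_zero.2 hu'.ne'
    have h := integral_cpow_mul_exp_neg_mul_exp_neg_div ha2 x hu'
    have e1 : ∀ τ ∈ Ioi (0 : ℝ), (τ : ℂ) ^ (a - 1) * Complex.exp (-τ) *
        ((x * √(2 * τ) / 2 * Real.exp (-u - (x * √(2 * τ) / 2) ^ 2 / u) / (u * √u) : ℝ) : ℂ) =
        x * (√2 : ℝ) / 2 * Complex.exp (-u) / (u * (√u : ℝ)) *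
        ((τ : ℂ) ^ (a + 1 / 2 - 1) * Complex.exp (-τ) *
        ((Real.exp (-(x ^ 2 * τ / 2 / u)) : ℝ) : ℂ)) := by
      intro τ hτ
      have hτ' : (0 : ℝ) < τ := hτ
      rw [add_sub_right_comm, Complex.cpow_add _ _ (Complex.ofReal_ne_zero.2 hτ'.ne'),
        ← ofReal_sqrt_eq_cpow hτ'.le, sq_mul_sqrt_two_mul_div_two x hτ'.le,
        sub_eq_add_neg (-u), Real.exp_add, Real.sqrt_mul zero_le_two]
      push_cast
      ring
    rw [setIntegral_congr_fun measurableSet_Ioi e1, integral_const_mul, h, tricomiIntegrand,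
      Complex.cpow_add _ _ two_ne_zero, Complex.cpow_add _ _ hu0, ← ofReal_sqrt_eq_cpow hu'.le,
      two_cpow_half, Complex.cpow_sub _ _ hu0, Complex.cpow_one]
    have hsu : ((√u : ℝ) : ℂ) ≠ 0 := Complex.ofReal_ne_zero.2 (by positivity)
    generalize ((x ^ 2 + 2 * u : ℝ) : ℂ) ^ (-(a + 1 / 2)) = c
    generalize Complex.Gamma (a + 1 / 2) = g
    field_simp
    rw [ofReal_sqrt_two_sq]

open MeasureTheory Set in
/-- The kernel here is that of `integral_exp_neg_sub_div_sqrt` with `q = x √(2τ) / 2`. -/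
theorem parabolicCylinderD_eq_tricomi_add_half_left_of_pos {a : ℂ} (ha : 0 < a.re) {x : ℝ}
    (hx : 0 < x) :
    IntegrableOn (tricomiIntegrand (a + 1 / 2) a x) (Ioi 0) ∧
      parabolicCylinderD (-2 * a) x =
        Complex.exp (-(x : ℂ) ^ 2 / 4) / Complex.Gamma (a + 1 / 2) *
          ∫ u in Ioi (0 : ℝ), tricomiIntegrand (a + 1 / 2) a x u := by
  have hg1 : Complex.Gamma a ≠ 0 := Complex.Gamma_ne_zero_of_re_pos ha
  have h2a := two_cpow_ne_zero a
  have hmain := parabolicCylinderD_eq_integral_of_kernel ha hx.le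
    (k := fun τ u => Real.exp (-u - (x * √(2 * τ) / 2) ^ 2 / u) / √u)
    (T := tricomiIntegrand (a + 1 / 2) a x) (C := 2 ^ a * Complex.Gamma a)
    (by unfold Function.uncurry; fun_prop)
    (fun τ hτ u hu => by positivity)
    (fun τ hτ => by
      have hτ' := mem_Ioi.1 hτ
      have h := integral_exp_neg_sub_div_sqrt (q := x * √(2 * τ) / 2) (by positivity)
      rwa [show -2 * (x * √(2 * τ) / 2) = -(x * √(2 * τ)) by ring] at h)
    (mul_ne_zero h2a hg1) ?_
  · refine ⟨hmain.1, hmain.2.trans ?_⟩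
    generalize Complex.Gamma (a + 1 / 2) = g at *
    congr 1
    field_simp
  · intro u hu
    have hu' : (0 : ℝ) < u := hu
    have hu0 : (u : ℂ) ≠ 0 := Complex.ofReal_ne_zero.2 hu'.ne'
    have h := integral_cpow_mul_exp_neg_mul_exp_neg_div ha x hu'
    have e1 : ∀ τ ∈ Ioi (0 : ℝ), (τ : ℂ) ^ (a - 1) * Complex.exp (-τ) *
        ((Real.exp (-u - (x * √(2 * τ) / 2) ^ 2 / u) / √u : ℝ) : ℂ) =
        Complex.exp (-u) / (√u : ℝ) * ((τ : ℂ) ^ (a - 1) * Complex.exp (-τ) *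
        ((Real.exp (-(x ^ 2 * τ / 2 / u)) : ℝ) : ℂ)) := by
      intro τ hτ
      have hτ' : (0 : ℝ) < τ := hτ
      rw [sq_mul_sqrt_two_mul_div_two x hτ'.le, sub_eq_add_neg (-u), Real.exp_add]
      push_cast
      ring
    rw [setIntegral_congr_fun measurableSet_Ioi e1, integral_const_mul, h, tricomiIntegrand,
      show a + 1 / 2 - 1 = a - 1 / 2 by ring, Complex.cpow_sub _ _ hu0,
      ← ofReal_sqrt_eq_cpow hu'.le]
    ring

theorem tricomiIntegrand_sub_half_right (a : ℂ) (x : ℝ) {u : ℝ} (hu : 0 < u) :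
    tricomiIntegrand a (a - 1 / 2) x u = (x : ℂ) ^ 2 * tricomiIntegrand a (a + 1 / 2) x u +
      2 * tricomiIntegrand (a + 1 / 2 + 1 / 2) (a + 1 / 2) x u := by
  have hu0 : (u : ℂ) ≠ 0 := Complex.ofReal_ne_zero.2 hu.ne'
  have h0 : ((x ^ 2 + 2 * u : ℝ) : ℂ) ≠ 0 := Complex.ofReal_ne_zero.2 (by positivity)
  rw [tricomiIntegrand, tricomiIntegrand, tricomiIntegrand,
    show a + 1 / 2 + 1 / 2 - 1 = a - 1 + 1 by ring, Complex.cpow_add _ _ hu0, Complex.cpow_one,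
    show -(a - 1 / 2) = -(a + 1 / 2) + 1 by ring, Complex.cpow_add _ _ h0, Complex.cpow_one]
  push_cast
  ring

theorem kummerPhi_zero (a b : ℂ) : kummerPhi a b 0 = 1 := by
  rw [kummerPhi, tsum_eq_single 0 fun n hn => by rw [zero_pow hn, mul_zero]]
  simp

theorem parabolicCylinderD_zero (a : ℂ) :
    parabolicCylinderD (-2 * a) 0 = 2 ^ (-a) * (√Real.pi : ℝ) / Complex.Gamma (a + 1 / 2) := by
  rw [parabolicCylinderD_neg_two_mul]
  simp [kummerPhi_zero, div_eq_mul_inv]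

open MeasureTheory Set in
/-- The representation with parameters `(a + 1/2, a)` holds down to `Re a > -1/2`. For `x > 0` it
is deduced from the recurrence for `D`, which the integrals satisfy because of a linear relation
between their integrands; for `x = 0` both sides are explicit. -/
theorem parabolicCylinderD_eq_tricomi_add_half_left {a : ℂ} (ha : -(1 / 2) < a.re) {x : ℝ}
    (hx : 0 ≤ x) :
    IntegrableOn (tricomiIntegrand (a + 1 / 2) a x) (Ioi 0) ∧
      parabolicCylinderD (-2 * a) x =
        Complex.exp (-(x : ℂ) ^ 2 / 4) / Complex.Gamma (a + 1 / 2) *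
          ∫ u in Ioi (0 : ℝ), tricomiIntegrand (a + 1 / 2) a x u := by
  rcases hx.eq_or_lt with rfl | hx
  · have e : ∀ u ∈ Ioi (0 : ℝ), 2 ^ (-a) * ((u : ℂ) ^ (1 / 2 - 1 : ℂ) * Complex.exp (-u)) =
        tricomiIntegrand (a + 1 / 2) a 0 u := by
      intro u hu
      have hu' : (0 : ℝ) < u := hu
      rw [tricomiIntegrand, show a + 1 / 2 - 1 = 1 / 2 - 1 + a by ring,
        Complex.cpow_add _ _ (Complex.ofReal_ne_zero.2 hu'.ne'), zero_pow two_ne_zero, zero_add,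
        ofReal_mul_cpow zero_le_two hu'.le, Complex.ofReal_ofNat, Complex.cpow_neg (u : ℂ)]
      have : (u : ℂ) ^ a ≠ 0 := by
        simp [Complex.cpow_eq_zero_iff, hu'.ne']
      field_simp
    have hre : 0 < (1 / 2 : ℂ).re := by norm_num
    refine ⟨IntegrableOn.congr_fun ((integrableOn_cpow_mul_exp_neg hre).const_mul _) e
      measurableSet_Ioi, ?_⟩
    rw [← setIntegral_congr_fun measurableSet_Ioi e, integral_const_mul,
      setIntegral_cpow_mul_exp_neg hre, gamma_half, Complex.ofReal_zero, parabolicCylinderD_zero]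
    simp only [ne_eq, OfNat.ofNat_ne_zero, not_false_eq_true, zero_pow, neg_zero, zero_div,
      Complex.exp_zero]
    ring
  -- With `b = a + 1/2`, the right-hand side of the recurrence only involves the parameters `b` and
  -- `b + 1/2`, which have positive real part.
  · obtain ⟨b, rfl⟩ : ∃ b, a = b - 1 / 2 := ⟨a + 1 / 2, by ring⟩
    have hb : 0 < b.re := by
      rw [Complex.sub_re] at ha
      norm_num at ha
      exact ha
    have hb0 : b ≠ 0 := by rintro rfl; simp at hb
    obtain ⟨iA, hA⟩ := parabolicCylinderD_eq_tricomi_add_half_right hb hx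
    obtain ⟨iB, hB⟩ := parabolicCylinderD_eq_tricomi_add_half_left_of_pos (add_half_re_pos hb) hx
    have e : ∀ u ∈ Ioi (0 : ℝ), (x : ℂ) ^ 2 * tricomiIntegrand b (b + 1 / 2) x u +
        2 * tricomiIntegrand (b + 1 / 2 + 1 / 2) (b + 1 / 2) x u =
        tricomiIntegrand b (b - 1 / 2) x u := fun u hu =>
      (tricomiIntegrand_sub_half_right b x hu).symm
    rw [sub_add_cancel]
    refine ⟨IntegrableOn.congr_fun ((iA.const_mul _).add (iB.const_mul _)) e measurableSet_Ioi, ?_⟩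
    rw [← setIntegral_congr_fun measurableSet_Ioi e,
      integral_add (iA.const_mul _) (iB.const_mul _), integral_const_mul, integral_const_mul,
      parabolicCylinderD_recurrence hb, hA, hB, show b + 1 / 2 + 1 / 2 = b + 1 by ring,
      Complex.Gamma_add_one b hb0]
    have hg : Complex.Gamma b ≠ 0 := Complex.Gamma_ne_zero_of_re_pos hb
    generalize ∫ u in Ioi (0 : ℝ), tricomiIntegrand b (b + 1 / 2) x u = I1
    generalize ∫ u in Ioi (0 : ℝ), tricomiIntegrand (b + 1) (b + 1 / 2) x u = I2
    field_simp

/-! ### The convolution of the two integrals -/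

theorem gaussArg_nonneg (x y : ℝ) {t : ℝ} (ht : 0 < t) : 0 ≤ gaussArg x y t := by
  rw [gaussArg]; positivity

theorem gaussArg_le_one (x y : ℝ) {t : ℝ} (ht : 0 < t) : gaussArg x y t ≤ 1 := by
  rw [gaussArg, div_le_one (by positivity)]
  nlinarith [mul_nonneg (sq_nonneg x) (sq_nonneg y)]

theorem gaussArg_zero_left (y : ℝ) {t : ℝ} (ht : 0 < t) : gaussArg 0 y t = 1 := by
  have : 0 < y ^ 2 + 2 * t := by positivity
  rw [gaussArg, zero_pow two_ne_zero, zero_add, zero_add, div_self (by positivity)]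

theorem productIntegrand_neg_two_mul (a b : ℂ) (x y t : ℝ) :
    productIntegrand (-2 * a) (-2 * b) x y t = Complex.exp (-(t : ℂ)) *
      (t : ℂ) ^ (a + b - 1 / 2) * ((x ^ 2 + 2 * t : ℝ) : ℂ) ^ (-a) *
      ((y ^ 2 + 2 * t : ℝ) : ℂ) ^ (-b) *
      ₂F₁ a b (a + (b + 1 / 2)) ((gaussArg x y t : ℝ) : ℂ) := by
  rw [productIntegrand, show -2 * a / 2 = -a by ring, show -2 * b / 2 = -b by ring,
    show -(-2 * a) / 2 = a by ring, show -(-2 * b) / 2 = b by ring,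
    show -(1 + -2 * a + -2 * b) / 2 = a + b - 1 / 2 by ring,
    show (1 - -2 * a - -2 * b) / 2 = a + (b + 1 / 2) by ring]

theorem ofReal_cpow_eq_exp_log {p : ℝ} (hp : 0 < p) (s : ℂ) :
    (p : ℂ) ^ s = Complex.exp (Real.log p * s) := by
  rw [Complex.cpow_def_of_ne_zero (Complex.ofReal_ne_zero.2 hp.ne'), Complex.ofReal_log hp.le]

open Set in
/-- The Möbius map `s ↦ t x² s / (x² + 2t - 2ts)` is a bijection from `(0, 1)` onto `(0, t)`. -/
theorem bijOn_moebius {x t : ℝ} (hx : 0 < x) (ht : 0 < t) :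
    BijOn (fun s => t * x ^ 2 * s / (x ^ 2 + 2 * t - 2 * t * s)) (Ioo 0 1) (Ioo 0 t) := by
  have hE (s : ℝ) (hs : s ∈ Ioo (0 : ℝ) 1) : 0 < x ^ 2 + 2 * t - 2 * t * s := by
    nlinarith [mul_pos ht (sub_pos.2 hs.2), sq_pos_of_pos hx]
  refine InvOn.bijOn (f' := fun u => u * (x ^ 2 + 2 * t) / (t * (x ^ 2 + 2 * u)))
    ⟨fun s hs => ?_, fun u hu => ?_⟩ (fun s hs => ?_) fun u hu => ?_
  · have h := hE s hs
    have h1 : 0 < x ^ 2 + 2 * (t * x ^ 2 * s / (x ^ 2 + 2 * t - 2 * t * s)) := by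
      have := hs.1
      positivity
    have h2 : x ^ 2 + 2 * (t * x ^ 2 * s / (x ^ 2 + 2 * t - 2 * t * s)) =
        x ^ 2 * (x ^ 2 + 2 * t) / (x ^ 2 + 2 * t - 2 * t * s) := by
      field_simp
      ring
    have h3 : 0 < x ^ 2 + 2 * t := by positivity
    simp only [h2]
    generalize x ^ 2 + 2 * t - 2 * t * s = E at h ⊢
    field_simp
  · have hu0 : 0 < x ^ 2 + 2 * u := by have := hu.1; positivity
    have h2 : x ^ 2 + 2 * t - 2 * t * (u * (x ^ 2 + 2 * t) / (t * (x ^ 2 + 2 * u))) =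
        x ^ 2 * (x ^ 2 + 2 * t) / (x ^ 2 + 2 * u) := by
      field_simp
      ring
    have h3 : 0 < x ^ 2 + 2 * t := by positivity
    simp only [h2]
    generalize x ^ 2 + 2 * u = U at hu0 ⊢
    field_simp
  · have h := hE s hs
    have h0 := hs.1
    refine ⟨by positivity, ?_⟩
    rw [div_lt_iff₀ h]
    nlinarith [mul_pos (mul_pos ht (sub_pos.2 hs.2)) (add_pos (sq_pos_of_pos hx) ht),
      mul_pos (mul_pos ht (sub_pos.2 hs.2)) ht]
  · have h0 := hu.1
    have h1 := hu.2
    have hu0 : 0 < x ^ 2 + 2 * u := by positivity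
    refine ⟨by positivity, ?_⟩
    rw [div_lt_one (by positivity)]
    nlinarith [mul_pos (sub_pos.2 h1) (sq_pos_of_pos hx)]

/-- Under the Möbius substitution all powers of the denominator cancel. -/
theorem tricomiIntegrand_mul_tricomiIntegrand_moebius (a b : ℂ) {x y t s : ℝ} (hx : 0 < x)
    (ht : 0 < t) (hs0 : 0 < s) (hs1 : s < 1) :
    (t * x ^ 2 * (x ^ 2 + 2 * t) / (x ^ 2 + 2 * t - 2 * t * s) ^ 2 : ℝ) *
      (tricomiIntegrand a (a + 1 / 2) x (t * x ^ 2 * s / (x ^ 2 + 2 * t - 2 * t * s)) *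
        tricomiIntegrand (b + 1 / 2) b y (t - t * x ^ 2 * s / (x ^ 2 + 2 * t - 2 * t * s))) =
    (x : ℂ)⁻¹ * (Complex.exp (-(t : ℂ)) * (t : ℂ) ^ (a + b - 1 / 2) *
      ((x ^ 2 + 2 * t : ℝ) : ℂ) ^ (-a) * ((y ^ 2 + 2 * t : ℝ) : ℂ) ^ (-b)) *
      ((s : ℂ) ^ (a - 1) * (1 - (s : ℂ)) ^ (b + 1 / 2 - 1) *
        (1 - ((gaussArg x y t * s : ℝ) : ℂ)) ^ (-b)) := by
  have hE : 0 < x ^ 2 + 2 * t - 2 * t * s := by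
    nlinarith [mul_pos ht (sub_pos.2 hs1), sq_pos_of_pos hx]
  have hX : 0 < x ^ 2 + 2 * t := by positivity
  have hY : 0 < y ^ 2 + 2 * t := by positivity
  have hs : 0 < 1 - s := sub_pos.2 hs1
  have hz : 0 < 1 - gaussArg x y t * s := by
    nlinarith [gaussArg_nonneg x y ht, gaussArg_le_one x y ht]
  have h1 : t - t * x ^ 2 * s / (x ^ 2 + 2 * t - 2 * t * s) =
      t * (1 - s) * (x ^ 2 + 2 * t) / (x ^ 2 + 2 * t - 2 * t * s) := by
    rw [eq_div_iff hE.ne', sub_mul, div_mul_cancel₀ _ hE.ne']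
    ring
  have h2 : x ^ 2 + 2 * (t * x ^ 2 * s / (x ^ 2 + 2 * t - 2 * t * s)) =
      x ^ 2 * (x ^ 2 + 2 * t) / (x ^ 2 + 2 * t - 2 * t * s) := by
    field_simp
    ring
  have h3 : y ^ 2 + 2 * (t * (1 - s) * (x ^ 2 + 2 * t) / (x ^ 2 + 2 * t - 2 * t * s)) =
      (y ^ 2 + 2 * t) * (x ^ 2 + 2 * t) * (1 - gaussArg x y t * s) /
        (x ^ 2 + 2 * t - 2 * t * s) := by
    rw [gaussArg]
    field_simp
    ring
  have h4 : Complex.exp (-((t * x ^ 2 * s / (x ^ 2 + 2 * t - 2 * t * s) : ℝ) : ℂ)) *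
      Complex.exp (-((t - t * x ^ 2 * s / (x ^ 2 + 2 * t - 2 * t * s) : ℝ) : ℂ)) =
      Complex.exp (-(t : ℂ)) := by
    rw [← Complex.exp_add]
    congr 1
    push_cast
    ring
  rw [tricomiIntegrand, tricomiIntegrand, ← h4, h1, h2, h3]
  -- Every remaining factor is a complex power of a positive real, so taking real logarithms turns
  -- the identity into a linear one between exponents.
  have e1 : (1 - (s : ℂ)) = ((1 - s : ℝ) : ℂ) := by push_cast; rfl
  have e2 : (1 - ((gaussArg x y t * s : ℝ) : ℂ)) = ((1 - gaussArg x y t * s : ℝ) : ℂ) := by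
    push_cast; rfl
  have e3 : (x : ℂ)⁻¹ = (x : ℂ) ^ (-1 : ℂ) := (Complex.cpow_neg_one _).symm
  have e4 (p : ℝ) : (p : ℂ) = (p : ℂ) ^ (1 : ℂ) := (Complex.cpow_one _).symm
  rw [e1, e2, e3, e4 (t * x ^ 2 * (x ^ 2 + 2 * t) / (x ^ 2 + 2 * t - 2 * t * s) ^ 2)]
  generalize Complex.exp (-((t * x ^ 2 * s / (x ^ 2 + 2 * t - 2 * t * s) : ℝ) : ℂ)) = f1
  generalize Complex.exp (-((t * (1 - s) * (x ^ 2 + 2 * t) /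
    (x ^ 2 + 2 * t - 2 * t * s) : ℝ) : ℂ)) = f2
  generalize 1 - gaussArg x y t * s = w at *
  generalize x ^ 2 + 2 * t - 2 * t * s = E at *
  generalize x ^ 2 + 2 * t = X at *
  generalize y ^ 2 + 2 * t = Y at *
  generalize 1 - s = r at *
  have key : ((t * x ^ 2 * X / E ^ 2 : ℝ) : ℂ) ^ (1 : ℂ) *
      (((t * x ^ 2 * s / E : ℝ) : ℂ) ^ (a - 1) * ((x ^ 2 * X / E : ℝ) : ℂ) ^ (-(a + 1 / 2)) *
      (((t * r * X / E : ℝ) : ℂ) ^ (b + 1 / 2 - 1) * ((Y * X * w / E : ℝ) : ℂ) ^ (-b))) =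
      (x : ℂ) ^ (-1 : ℂ) * ((t : ℂ) ^ (a + b - 1 / 2) * (X : ℂ) ^ (-a) * (Y : ℂ) ^ (-b)) *
      ((s : ℂ) ^ (a - 1) * (r : ℂ) ^ (b + 1 / 2 - 1) * (w : ℂ) ^ (-b)) := by
    have hx2 : 0 < x ^ 2 := by positivity
    have hE2 : 0 < E ^ 2 := by positivity
    rw [ofReal_cpow_eq_exp_log (p := t * x ^ 2 * X / E ^ 2) (by positivity),
      ofReal_cpow_eq_exp_log (p := t * x ^ 2 * s / E) (by positivity),
      ofReal_cpow_eq_exp_log (p := x ^ 2 * X / E) (by positivity),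
      ofReal_cpow_eq_exp_log (p := t * r * X / E) (by positivity),
      ofReal_cpow_eq_exp_log (p := Y * X * w / E) (by positivity),
      ofReal_cpow_eq_exp_log hx, ofReal_cpow_eq_exp_log ht, ofReal_cpow_eq_exp_log hX,
      ofReal_cpow_eq_exp_log hY, ofReal_cpow_eq_exp_log hs0, ofReal_cpow_eq_exp_log hs,
      ofReal_cpow_eq_exp_log hz]
    simp only [← Complex.exp_add]
    congr 1
    rw [Real.log_div (by positivity) hE2.ne', Real.log_div (by positivity) hE.ne',
      Real.log_div (by positivity) hE.ne', Real.log_div (by positivity) hE.ne',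
      Real.log_div (by positivity) hE.ne', Real.log_mul (by positivity) hX.ne',
      Real.log_mul ht.ne' hx2.ne', Real.log_mul (by positivity) hs0.ne',
      Real.log_mul ht.ne' hx2.ne', Real.log_mul hx2.ne' hX.ne', Real.log_mul (by positivity) hX.ne',
      Real.log_mul ht.ne' hs.ne', Real.log_mul (by positivity) hz.ne',
      Real.log_mul hY.ne' hX.ne', Real.log_pow, Real.log_pow]
    push_cast
    ring
  linear_combination f1 * f2 * key

open MeasureTheory Set in
/-- The convolution of the two integrands is Euler's integral for the Gauss function, after the
substitution of `bijOn_moebius`. -/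
theorem intervalIntegral_tricomiIntegrand_mul {a b : ℂ} (ha : 0 < a.re) (hb : -(1 / 2) < b.re)
    {x t : ℝ} (y : ℝ) (hx : 0 < x) (ht : 0 < t) :
    ∫ u in (0 : ℝ)..t,
        tricomiIntegrand a (a + 1 / 2) x u * tricomiIntegrand (b + 1 / 2) b y (t - u) =
      (x : ℂ)⁻¹ * Complex.betaIntegral a (b + 1 / 2) *
        productIntegrand (-2 * a) (-2 * b) x y t := by
  have hd : 0 < (b + 1 / 2).re := by rw [Complex.add_re]; norm_num; linarith
  have hbd : b.re < (b + 1 / 2).re := by rw [Complex.add_re]; norm_num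
  have hbij := bijOn_moebius hx ht
  rw [intervalIntegral.integral_of_le ht.le, integral_Ioc_eq_integral_Ioo, ← hbij.image_eq,
    integral_image_eq_integral_abs_deriv_smul measurableSet_Ioo
      (f' := fun s => t * x ^ 2 * (x ^ 2 + 2 * t) / (x ^ 2 + 2 * t - 2 * t * s) ^ 2)
      (fun s hs => ?_) hbij.injOn]
  · have e : ∀ s ∈ Ioo (0 : ℝ) 1,
        |t * x ^ 2 * (x ^ 2 + 2 * t) / (x ^ 2 + 2 * t - 2 * t * s) ^ 2| •
        (tricomiIntegrand a (a + 1 / 2) x (t * x ^ 2 * s / (x ^ 2 + 2 * t - 2 * t * s)) *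
        tricomiIntegrand (b + 1 / 2) b y (t - t * x ^ 2 * s / (x ^ 2 + 2 * t - 2 * t * s))) =
        (x : ℂ)⁻¹ * (Complex.exp (-(t : ℂ)) * (t : ℂ) ^ (a + b - 1 / 2) *
        ((x ^ 2 + 2 * t : ℝ) : ℂ) ^ (-a) * ((y ^ 2 + 2 * t : ℝ) : ℂ) ^ (-b)) *
        ((s : ℂ) ^ (a - 1) * (1 - (s : ℂ)) ^ (b + 1 / 2 - 1) *
        (1 - ((gaussArg x y t * s : ℝ) : ℂ)) ^ (-b)) := by
      intro s hs
      rw [abs_of_nonneg (by positivity), Complex.real_smul]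
      exact tricomiIntegrand_mul_tricomiIntegrand_moebius a b hx ht hs.1 hs.2
    rw [setIntegral_congr_fun measurableSet_Ioo e, integral_const_mul,
      integral_euler_eq_ordinaryHypergeometric ha hd hbd (gaussArg_nonneg x y ht)
        (gaussArg_le_one x y ht), productIntegrand_neg_two_mul]
    ring
  · have hE : 0 < x ^ 2 + 2 * t - 2 * t * s := by
      nlinarith [mul_pos ht (sub_pos.2 hs.2), sq_pos_of_pos hx]
    have h1 : HasDerivAt (fun s => t * x ^ 2 * s) (t * x ^ 2) s := by
      simpa using (hasDerivAt_id s).const_mul (t * x ^ 2)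
    have h2 : HasDerivAt (fun s => x ^ 2 + 2 * t - 2 * t * s) (-(2 * t)) s := by
      simpa using ((hasDerivAt_id s).const_mul (2 * t)).const_sub (x ^ 2 + 2 * t)
    refine ((h1.div h2 hE.ne').congr_deriv ?_).hasDerivWithinAt
    congr 1
    ring

open MeasureTheory Set in
theorem parabolicCylinderD_mul_of_pos {a b : ℂ} (ha : 0 < a.re) (hb : -(1 / 2) < b.re)
    {x y : ℝ} (hx : 0 < x) (hy : 0 ≤ y) :
    IntegrableOn (productIntegrand (-2 * a) (-2 * b) x y) (Ioi 0) ∧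
      parabolicCylinderD (-2 * a) x * parabolicCylinderD (-2 * b) y =
        Complex.exp (-((x : ℂ) ^ 2 + (y : ℂ) ^ 2) / 4) / Complex.Gamma (a + (b + 1 / 2)) *
          ∫ t in Ioi (0 : ℝ), productIntegrand (-2 * a) (-2 * b) x y t := by
  have hd : 0 < (b + 1 / 2).re := by rw [Complex.add_re]; norm_num; linarith
  have hg1 : Complex.Gamma a ≠ 0 := Complex.Gamma_ne_zero_of_re_pos ha
  have hg2 : Complex.Gamma (b + 1 / 2) ≠ 0 := Complex.Gamma_ne_zero_of_re_pos hd
  have hg3 : Complex.Gamma (a + (b + 1 / 2)) ≠ 0 :=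
    Complex.Gamma_ne_zero_of_re_pos (by rw [Complex.add_re]; positivity)
  have hx0 : (x : ℂ) ≠ 0 := Complex.ofReal_ne_zero.2 hx.ne'
  obtain ⟨iA, hA⟩ := parabolicCylinderD_eq_tricomi_add_half_right ha hx
  obtain ⟨iB, hB⟩ := parabolicCylinderD_eq_tricomi_add_half_left hb hy
  have hbeta := Complex.betaIntegral_eq_Gamma_mul_div a (b + 1 / 2) ha hd
  have hC : (x : ℂ)⁻¹ * Complex.betaIntegral a (b + 1 / 2) ≠ 0 := by
    rw [hbeta]
    exact mul_ne_zero (inv_ne_zero hx0) (div_ne_zero (mul_ne_zero hg1 hg2) hg3)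
  have hconv : ∀ t ∈ Ioi (0 : ℝ), ∫ u in (0 : ℝ)..t,
      ContinuousLinearMap.mul ℝ ℂ (tricomiIntegrand a (a + 1 / 2) x u)
        (tricomiIntegrand (b + 1 / 2) b y (t - u)) =
      (x : ℂ)⁻¹ * Complex.betaIntegral a (b + 1 / 2) *
        productIntegrand (-2 * a) (-2 * b) x y t := fun t ht => by
    simp only [ContinuousLinearMap.mul_apply']
    exact intervalIntegral_tricomiIntegrand_mul ha hb y hx ht
  refine ⟨?_, ?_⟩
  · have h := (integrable_posConvolution iA iB (ContinuousLinearMap.mul ℝ ℂ)).integrableOn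
      (s := Ioi 0)
    refine (integrable_const_mul_iff hC.isUnit _).1 (h.congr_fun (fun t ht => ?_) measurableSet_Ioi)
    rw [posConvolution, indicator_of_mem ht]
    exact hconv t ht
  · have h := integral_posConvolution iA iB (ContinuousLinearMap.mul ℝ ℂ)
    rw [setIntegral_congr_fun measurableSet_Ioi hconv, integral_const_mul, hbeta,
      ContinuousLinearMap.mul_apply'] at h
    rw [hA, hB, neg_add, add_div, Complex.exp_add, neg_div, neg_div]
    generalize Complex.Gamma (b + 1 / 2) = g2 at *
    generalize Complex.Gamma (a + (b + 1 / 2)) = g3 at *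
    generalize ∫ u in Ioi (0 : ℝ), tricomiIntegrand a (a + 1 / 2) x u = I1 at *
    generalize ∫ u in Ioi (0 : ℝ), tricomiIntegrand (b + 1 / 2) b y u = I2 at *
    generalize ∫ t in Ioi (0 : ℝ), productIntegrand (-2 * a) (-2 * b) x y t = I3 at *
    generalize Complex.exp (-((x : ℂ) ^ 2 / 4)) = f1
    generalize Complex.exp (-((y : ℂ) ^ 2 / 4)) = f2
    calc x * f1 / Complex.Gamma a * I1 * (f2 / g2 * I2)
        = x * f1 * f2 / (Complex.Gamma a * g2) * (I1 * I2) := by field_simp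
      _ = _ := by rw [← h]; field_simp

open MeasureTheory Set in
/-- At `x = 0` the argument of the Gauss function is constantly `1`, so that the product formula is
the representation of the second factor together with Gauss's summation theorem. -/
theorem parabolicCylinderD_mul_of_zero_left {a b : ℂ} (ha : 0 < a.re) (hb : -(1 / 2) < b.re)
    {y : ℝ} (hy : 0 ≤ y) :
    IntegrableOn (productIntegrand (-2 * a) (-2 * b) 0 y) (Ioi 0) ∧
      parabolicCylinderD (-2 * a) 0 * parabolicCylinderD (-2 * b) y =
        Complex.exp (-((y : ℂ) ^ 2) / 4) / Complex.Gamma (a + (b + 1 / 2)) *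
          ∫ t in Ioi (0 : ℝ), productIntegrand (-2 * a) (-2 * b) 0 y t := by
  have hd : 0 < (b + 1 / 2).re := by rw [Complex.add_re]; norm_num; linarith
  have hbd : b.re < (b + 1 / 2).re := by rw [Complex.add_re]; norm_num
  have hg1 : Complex.Gamma a ≠ 0 := Complex.Gamma_ne_zero_of_re_pos ha
  have hg2 : Complex.Gamma (b + 1 / 2) ≠ 0 := Complex.Gamma_ne_zero_of_re_pos hd
  have hg3 : Complex.Gamma (a + (b + 1 / 2)) ≠ 0 :=
    Complex.Gamma_ne_zero_of_re_pos (by rw [Complex.add_re]; positivity)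
  have hg4 : Complex.Gamma (a + 1 / 2) ≠ 0 := Complex.Gamma_ne_zero_of_re_pos (add_half_re_pos ha)
  obtain ⟨iB, hB⟩ := parabolicCylinderD_eq_tricomi_add_half_left hb hy
  have hgauss := betaIntegral_mul_ordinaryHypergeometric_one ha hd hbd
  rw [show b + 1 / 2 - b = 1 / 2 by ring, Complex.betaIntegral_eq_Gamma_mul_div _ _ ha hd,
    Complex.betaIntegral_eq_Gamma_mul_div _ _ ha (by norm_num), gamma_half] at hgauss
  have e : ∀ t ∈ Ioi (0 : ℝ), 2 ^ (-a) * ₂F₁ a b (a + (b + 1 / 2)) (1 : ℂ) *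
      tricomiIntegrand (b + 1 / 2) b y t = productIntegrand (-2 * a) (-2 * b) 0 y t := by
    intro t ht
    have ht' : (0 : ℝ) < t := ht
    have ht0 : (t : ℂ) ≠ 0 := Complex.ofReal_ne_zero.2 ht'.ne'
    rw [productIntegrand_neg_two_mul, gaussArg_zero_left y ht', tricomiIntegrand,
      zero_pow two_ne_zero, zero_add, ofReal_mul_cpow zero_le_two ht'.le, Complex.ofReal_ofNat,
      Complex.ofReal_one, show a + b - 1 / 2 = (b + 1 / 2 - 1) + a by ring,
      Complex.cpow_add _ _ ht0, Complex.cpow_neg (t : ℂ)]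
    have : (t : ℂ) ^ a ≠ 0 := by simp [Complex.cpow_eq_zero_iff, ht'.ne']
    field_simp
  refine ⟨IntegrableOn.congr_fun (iB.const_mul _) e measurableSet_Ioi, ?_⟩
  rw [← setIntegral_congr_fun measurableSet_Ioi e, integral_const_mul, hB, parabolicCylinderD_zero]
  generalize Complex.Gamma (b + 1 / 2) = g2 at *
  generalize Complex.Gamma (a + (b + 1 / 2)) = g3 at *
  generalize Complex.Gamma (a + 1 / 2) = g4 at *
  generalize ₂F₁ a b (a + (b + 1 / 2)) (1 : ℂ) = F at *
  generalize ∫ u in Ioi (0 : ℝ), tricomiIntegrand (b + 1 / 2) b y u = I2 at *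
  have hF : F * g2 * g4 = (√Real.pi : ℝ) * g3 := by
    field_simp at hgauss
    linear_combination hgauss
  field_simp
  linear_combination (-I2) * hF

theorem mainTheorem1 (ν μ : ℂ) (hν : ν.re < 0) (hμ : μ.re < 1)
    (x y : ℝ) (hx : 0 ≤ x) (hy : 0 ≤ y) :
    (∀ t : ℝ, 0 < t → Summable (fun n : ℕ =>
      ordinaryHypergeometricCoefficient (-ν / 2) (-μ / 2) ((1 - ν - μ) / 2) n *
        ((gaussArg x y t : ℝ) : ℂ) ^ n)) ∧
    MeasureTheory.IntegrableOn (productIntegrand ν μ x y) (Set.Ioi 0) ∧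
    parabolicCylinderD ν (x : ℂ) * parabolicCylinderD μ (y : ℂ) =
      Complex.exp (-((x : ℂ) ^ 2 + (y : ℂ) ^ 2) / 4) / Complex.Gamma ((1 - ν - μ) / 2) *
        ∫ t in Set.Ioi (0 : ℝ), productIntegrand ν μ x y t := by
  -- The parameters of the Gauss function become `a`, `b` and `a + (b + 1/2)`.
  obtain ⟨a, rfl⟩ : ∃ a, ν = -2 * a := ⟨-ν / 2, by ring⟩
  obtain ⟨b, rfl⟩ : ∃ b, μ = -2 * b := ⟨-μ / 2, by ring⟩
  have ha : 0 < a.re := by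
    simp at hν
    exact hν
  have hb : -(1 / 2) < b.re := by
    simp at hμ
    linarith
  rw [show (1 - -2 * a - -2 * b) / 2 = a + (b + 1 / 2) by ring, show -(-2 * a) / 2 = a by ring,
    show -(-2 * b) / 2 = b by ring]
  refine ⟨fun t ht => ?_, ?_⟩
  · have hre : (a + (b + 1 / 2)).re = a.re + b.re + 1 / 2 := by
      simp only [Complex.add_re]
      norm_num
      ring
    have h := summable_norm_ordinaryHypergeometricCoefficient (a := a) (b := b)
      (c := a + (b + 1 / 2)) (by rw [hre]; linarith) (by rw [hre]; linarith)
    refine Summable.of_norm_bounded h fun n => ?_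
    rw [norm_mul, norm_pow, Complex.norm_real, Real.norm_of_nonneg (gaussArg_nonneg x y ht)]
    exact mul_le_of_le_one_right (norm_nonneg _)
      (pow_le_one₀ (gaussArg_nonneg x y ht) (gaussArg_le_one x y ht))
  · rcases hx.eq_or_lt with rfl | hx
    · have h := parabolicCylinderD_mul_of_zero_left ha hb hy
      rw [Complex.ofReal_zero, zero_pow two_ne_zero, zero_add]
      exact h
    · exact parabolicCylinderD_mul_of_pos ha hb hx hy
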